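/- Digraphs are finite and may have loops and multiple arcs. A digraph is eulerian if it is connected and every vertex has indegree equal to its outdegree. A directed circuit is a closed directed trail with at least one arc, considered up to cyclic shifts, and a directed circuit decomposition is a collection of directed circuits that together use every arc exactly once. All embeddings are cellular. A directed embedding of a digraph is an embedding in which every face is bounded by a directed closed walk; if the surface is oriented, a face is a proface if its directed boundary walk runs clockwise, and an antiface if it runs anticlockwise. Theorem 4.1. Let $D$ be an $n$-vertex eulerian digraph with vertex set $V$ and arc set $A$, and suppose that the underlying simple undirected graph of $D$ (in which two distinct vertices are adjacent if and only if some arc of $D$, in either direction, joins them) has minimum degree at least $(4n+2)/5$. Let $\mathcal{C}$ be a directed circuit decomposition of $D$. Then there is a directed embedding of $D$ in an oriented surface such that the boundary walks of the profaces are exactly the elements of $\mathcal{C}$, and there is exactly one antiface if $|V|+|A|+|\mathcal{C}|$ is odd, and there are exactly two antifaces if $|V|+|A|+|\mathcal{C}|$ is even. Moreover, this embedding has maximum genus among all directed embeddings of $D$ in orientable surfaces in which every element of $\mathcal{C}$ bounds a face. -/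

import Mathlib

/-- A digraph with vertex set `V` and arc set `A`; loops and multiple arcs are allowed.
The arc `a` goes from `src a` to `tgt a`. -/
structure MultiDigraph (V A : Type*) where
  src : A → V
  tgt : A → V

namespace MultiDigraph

variable {V A : Type*}

/-- The underlying simple graph: distinct `u`, `v` are adjacent iff some arc joins them, in
either direction. -/
def underlying (D : MultiDigraph V A) : SimpleGraph V :=
  SimpleGraph.fromRel (fun u v => ∃ a, D.src a = u ∧ D.tgt a = v)

/-- An eulerian digraph: connected, with indegree equal to outdegree at every vertex. -/
def IsEulerian (D : MultiDigraph V A) : Prop :=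
  D.underlying.Connected ∧
    ∀ v, Nat.card {a : A // D.tgt a = v} = Nat.card {a : A // D.src a = v}

/-- A directed circuit: a nontrivial closed directed trail, up to cyclic shift, given by its
cyclic sequence of arcs. -/
def IsCircuit (D : MultiDigraph V A) (C : Cycle A) : Prop :=
  C ≠ Cycle.nil ∧ C.Nodup ∧ C.Chain (fun a b => D.tgt a = D.src b)

/-- A directed circuit decomposition: a collection of directed circuits using every arc
exactly once. -/
def IsCircuitDecomposition (D : MultiDigraph V A) (𝒞 : Finset (Cycle A)) : Prop :=
  (∀ C ∈ 𝒞, D.IsCircuit C) ∧ ∀ a : A, ∃! C, C ∈ 𝒞 ∧ a ∈ C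

/-- Each arc `a` has two half-arcs, the outgoing one `Sum.inl a` at the vertex `src a` and the
incoming one `Sum.inr a` at the vertex `tgt a`. This is the incidence of half-arcs with
vertices; the other half of a half-arc `h` is `Equiv.sumComm A A h`. -/
def halfArcVertex (D : MultiDigraph V A) : A ⊕ A → V :=
  Sum.elim D.src D.tgt

/-- The arc to which a half-arc belongs. -/
def arcOf : A ⊕ A → A :=
  Sum.elim id id

/-- A cellular embedding of `D` in an oriented surface, represented by its rotation system:
`rot h` is the half-arc following `h` in the clockwise order around the vertex of `h`, so that
the cycles of `rot` are exactly the sets of all half-arcs at a vertex. -/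
structure OrientedEmbedding (D : MultiDigraph V A) where
  rot : Equiv.Perm (A ⊕ A)
  sameCycle_iff : ∀ h h', rot.SameCycle h h' ↔ D.halfArcVertex h = D.halfArcVertex h'

namespace OrientedEmbedding

variable {D : MultiDigraph V A} (Φ : OrientedEmbedding D)

/-- One step of face tracing. A facial walk traced clockwise has its face on the right-hand
side. If it leaves a vertex along the half-arc `h`, then it arrives at the next vertex along the
other half of `h`, and it leaves that vertex along the half-arc preceding this one in the
clockwise order. -/
def faceStep : Equiv.Perm (A ⊕ A) :=
  (Equiv.sumComm A A).trans Φ.rot.symm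

/-- The faces of the embedding. A face is given by its facial walk, traced clockwise: the
cyclic sequence of the half-arcs along which the walk leaves its successive vertices. -/
def faces : Set (Cycle (A ⊕ A)) :=
  Set.range (Function.periodicOrbit Φ.faceStep)

/-- The profaces: the clockwise facial walk follows the direction of all of its arcs. -/
def profaces : Set (Cycle (A ⊕ A)) :=
  {W | W ∈ Φ.faces ∧ ∀ h ∈ W, h.isLeft}

/-- The antifaces: the clockwise facial walk runs against the direction of all of its arcs,
so the anticlockwise one follows it. -/
def antifaces : Set (Cycle (A ⊕ A)) :=
  {W | W ∈ Φ.faces ∧ ∀ h ∈ W, h.isRight}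

/-- A directed embedding: every face is bounded by a directed closed walk. -/
def IsDirected : Prop :=
  ∀ W ∈ Φ.faces, W ∈ Φ.profaces ∨ W ∈ Φ.antifaces

/-- The directed closed walks, as cyclic sequences of arcs, that bound the profaces. -/
def profaceWalks : Set (Cycle A) :=
  {C | ∃ W ∈ Φ.profaces, C = W.map arcOf}

/-- The directed closed walks, as cyclic sequences of arcs, that bound the antifaces. They are
directed anticlockwise, hence the reversal. -/
def antifaceWalks : Set (Cycle A) :=
  {C | ∃ W ∈ Φ.antifaces, C = (W.map arcOf).reverse}

/-- The genus of the surface of an embedding of a connected digraph with at least one arc,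
given by the formula of Euler, `|V| - |A| + |F| = 2 - 2 * genus`. It is stated in `ℚ` so that
the division is exact. -/
noncomputable def genus [Fintype V] [Fintype A] : ℚ :=
  (2 - ((Fintype.card V : ℚ) - Fintype.card A + Φ.faces.ncard)) / 2

end OrientedEmbedding

end MultiDigraph

set_option linter.unusedSectionVars false

/-! Let `P` send every arc to its successor in its circuit. To embed `D` with these profaces is to
choose a cyclic order of the incoming arcs at every vertex, that is, a permutation `q` of the arcs
such that the cycles of `P⁻¹ * q` are the fibres of `D.tgt` (a tracing). The antifaces are the
cycles of `q`, run backwards. So the main point is a tracing with at most two cycles. Signs of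
permutations fix the parity of the number of faces, which decides between one and two. Any competing
embedding has a face besides those bounded by the circuits, and the same parity, so it has at least
as many faces.

Suppose that a tracing `q` with the fewest cycles has at least three. Composing `q` with a suitably
oriented 3-cycle inside one fibre gives a tracing again. If its three elements lie in three cycles,
these merge, against minimality; hence a fibre meets at most two cycles. If `x`, `y` share a cycle
and `z` lies in another one, the common cycle is split and one part is merged with the cycle of `z`;
the result is minimal again. Looking for contradictions after such surgery shows that a fibre
meeting the cycles of `a`, `b` and a fibre meeting those of `a`, `c` do not cross on the cycle of
`a`: each lies in one gap of the other (`IsMinTracing.hit_eq_hit`).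

Density enters by counting. Let every vertex be linked to all but at most `m` others. Inside one gap
of a fibre `y` only the first and the last position are next to `y`, so at most `m + 2` fibres can
have all their contacts with `y` in one gap (`IsTracing.ncard_gap_le`). Combined with the grid bound
`ncard_grid_le`, this shows that some cycle meets all fibres if `5 * m + 7 ≤ n`
(`IsMinTracing.exists_forall_touches`). This holds after each surgery too. Given fibres `u`, `w`
that join such a cycle to two further cycles, all fibres then fall into two sets of size at most `m
+ 2` and a grid of size at most `3 * m + 2`, a contradiction (`IsMinTracing.numCycles_le_two`). -/

namespace Equiv.Perm

/-! ### Cycles of a permutation under multiplication by a transposition. -/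

section Cycles

variable {α : Type*}

/-- An equivalence relation that relates every `a` to `f a` contains the cycles of `f`. -/
theorem SameCycle.rel_of_step [Finite α] {f : Perm α} {R : α → α → Prop} (hR : Equivalence R)
    (h : ∀ a, R a (f a)) {a b : α} (hab : f.SameCycle a b) : R a b := by
  obtain ⟨i, rfl⟩ := hab.exists_nat_pow_eq
  clear hab
  induction i with
  | zero => exact hR.refl _
  | succ i ih =>
    rw [pow_succ', mul_apply]
    exact hR.trans ih (h _)

theorem sameCycle_self_apply (f : Perm α) (a : α) : f.SameCycle a (f a) :=
  sameCycle_apply_right.2 (SameCycle.refl _ _)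

/-- A set that is mapped to itself by `f` is a union of cycles. -/
theorem SameCycle.mem_of_mapsTo [Finite α] {f : Perm α} {S : Set α} (h : ∀ a ∈ S, f a ∈ S)
    {a b : α} (hab : f.SameCycle a b) (ha : a ∈ S) : b ∈ S := by
  obtain ⟨i, rfl⟩ := hab.exists_nat_pow_eq
  clear hab
  induction i with
  | zero => exact ha
  | succ i ih =>
    rw [pow_succ', mul_apply]
    exact h _ ih

/-- The number of cycles, fixed points included. -/
noncomputable def numCycles (f : Perm α) : ℕ :=
  Nat.card (Quotient (SameCycle.setoid f))

theorem numCycles_one : numCycles (1 : Perm α) = Nat.card α := by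
  refine (Nat.card_eq_of_bijective (fun a : α => (⟦a⟧ : Quotient (SameCycle.setoid 1)))
    ⟨fun a b hab => ?_, Quotient.mk_surjective⟩).symm
  exact sameCycle_one.1 (Quotient.exact hab)

theorem numCycles_inv (f : Perm α) : numCycles f⁻¹ = numCycles f := by
  have : SameCycle.setoid f⁻¹ = SameCycle.setoid f := by
    ext a b; exact sameCycle_inv
  rw [numCycles, this, numCycles]

theorem exists_three_of_three_le_numCycles [Finite α] {f : Perm α} (h : 3 ≤ numCycles f) (a b : α) :
    ∃ c, ¬ f.SameCycle a c ∧ ¬ f.SameCycle b c := by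
  classical
  by_contra! hcon
  have : Fintype (Quotient (SameCycle.setoid f)) := Fintype.ofFinite _
  have hsub : (Finset.univ : Finset (Quotient (SameCycle.setoid f))) ⊆ {⟦a⟧, ⟦b⟧} := by
    intro c _
    induction c using Quotient.inductionOn with | _ c
    rw [Finset.mem_insert, Finset.mem_singleton]
    by_cases hac : f.SameCycle a c
    · left; exact Quotient.sound hac.symm
    · right; exact Quotient.sound (hcon c hac).symm
  have := Finset.card_le_card hsub
  rw [numCycles, Nat.card_eq_fintype_card] at h
  have h2 := Finset.card_le_two (a := (⟦a⟧ : Quotient (SameCycle.setoid f))) (b := ⟦b⟧)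
  rw [Finset.card_univ] at this
  omega

variable [Finite α] [DecidableEq α]

/-- The product sends `y` to `f x` and then follows the cycle of `x`, which avoids `y`, until it
arrives at `x`. -/
theorem sameCycle_mul_swap_of_not_sameCycle {f : Perm α} {x y : α} (h : ¬ f.SameCycle x y) :
    (f * swap x y).SameCycle x y := by
  have hxy : x ≠ y := fun e => h (e ▸ SameCycle.refl _ _)
  set g := f * swap x y with hg
  have hgy : g y = f x := by simp [hg]
  -- every iterate of `f` at `x` is reached by `g` from `y`
  obtain ⟨n, hn, hfn⟩ : ∃ n, 0 < n ∧ (f ^ n) x = x :=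
    ⟨orderOf f, orderOf_pos f, by rw [pow_orderOf_eq_one]; rfl⟩
  have key : ∀ i, (g.SameCycle y ((f ^ (i + 1)) x)) ∨ g.SameCycle y x := by
    intro i
    induction i with
    | zero => left; simpa [hgy] using sameCycle_self_apply g y
    | succ i ih =>
      rcases ih with ih | ih
      · by_cases hx : (f ^ (i + 1)) x = x
        · right; rwa [hx] at ih
        · left
          have hy : (f ^ (i + 1)) x ≠ y := fun e => h ⟨(i + 1 : ℕ), by rw [zpow_natCast]; exact e⟩
          have : g ((f ^ (i + 1)) x) = (f ^ (i + 1 + 1)) x := by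
            rw [hg, mul_apply, swap_apply_of_ne_of_ne hx hy, pow_succ' f (i + 1), mul_apply]
          rw [← this]
          exact ih.trans (sameCycle_self_apply _ _)
      · exact Or.inr ih
  rcases key (n - 1) with h1 | h1
  · rw [Nat.sub_add_cancel hn, hfn] at h1; exact h1.symm
  · exact h1.symm

/-- Multiplication by a transposition of elements of different cycles merges these cycles. -/
theorem sameCycle_mul_swap_iff {f : Perm α} {x y : α} (h : ¬ f.SameCycle x y) {a b : α} :
    (f * swap x y).SameCycle a b ↔ f.SameCycle a b ∨
      (f.SameCycle a x ∨ f.SameCycle a y) ∧ (f.SameCycle b x ∨ f.SameCycle b y) := by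
  set g := f * swap x y with hg
  have hgxy : g.SameCycle x y := sameCycle_mul_swap_of_not_sameCycle h
  have hstep : ∀ a, g.SameCycle a (f a) := by
    intro a
    by_cases hax : a = x
    · subst hax
      have : g y = f a := by simp [hg]
      rw [← this]; exact hgxy.trans (sameCycle_self_apply _ _)
    by_cases hay : a = y
    · subst hay
      have : g x = f a := by simp [hg]
      rw [← this]; exact hgxy.symm.trans (sameCycle_self_apply _ _)
    have : g a = f a := by rw [hg, mul_apply, swap_apply_of_ne_of_ne hax hay]
    rw [← this]; exact sameCycle_self_apply _ _
  have hfg : ∀ {a b}, f.SameCycle a b → g.SameCycle a b := fun hab =>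
    hab.rel_of_step (SameCycle.equivalence g) hstep
  constructor
  · refine fun hab => hab.rel_of_step (R := fun a b => f.SameCycle a b ∨
      (f.SameCycle a x ∨ f.SameCycle a y) ∧ (f.SameCycle b x ∨ f.SameCycle b y)) ⟨?_, ?_, ?_⟩ ?_
    · exact fun a => Or.inl (SameCycle.refl _ _)
    · rintro a b (h | h)
      · exact Or.inl h.symm
      · exact Or.inr ⟨h.2, h.1⟩
    · rintro a b c (h1 | h1) (h2 | h2)
      · exact Or.inl (h1.trans h2)
      · exact Or.inr ⟨h2.1.imp h1.trans h1.trans, h2.2⟩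
      · exact Or.inr ⟨h1.1, h1.2.imp h2.symm.trans h2.symm.trans⟩
      · exact Or.inr ⟨h1.1, h2.2⟩
    · intro a
      by_cases hax : a = x
      · subst hax
        right
        refine ⟨Or.inl (SameCycle.refl _ _), Or.inr ?_⟩
        simp [hg, sameCycle_apply_left, SameCycle.refl]
      by_cases hay : a = y
      · subst hay
        right
        refine ⟨Or.inr (SameCycle.refl _ _), Or.inl ?_⟩
        simp [hg, sameCycle_apply_left, SameCycle.refl]
      left
      rw [hg, mul_apply, swap_apply_of_ne_of_ne hax hay]
      exact sameCycle_self_apply _ _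
  · rintro (h | ⟨h1 | h1, h2 | h2⟩)
    · exact hfg h
    · exact hfg (h1.trans h2.symm)
    · exact (hfg h1).trans (hgxy.trans (hfg h2).symm)
    · exact (hfg h1).trans (hgxy.symm.trans (hfg h2).symm)
    · exact hfg (h1.trans h2.symm)

/-- Multiplication by a transposition of different elements of a cycle separates them. -/
theorem not_sameCycle_mul_swap {f : Perm α} {x y : α} (hxy : x ≠ y) (h : f.SameCycle x y) :
    ¬ (f * swap x y).SameCycle x y := by
  classical
  obtain ⟨i0, hi0⟩ := h.exists_nat_pow_eq
  have hex : ∃ i, (f ^ i) x = y := ⟨i0, hi0⟩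
  set n := Nat.find hex with hn
  have hny : (f ^ n) x = y := Nat.find_spec hex
  have hn0 : n ≠ 0 := fun e => hxy (by rw [← hny, e]; rfl)
  have hmin : ∀ j < n, (f ^ j) x ≠ y := fun j hj => Nat.find_min hex hj
  have hnx : ∀ j, 0 < j → j ≤ n → (f ^ j) x ≠ x := by
    intro j hj hjn e
    refine hmin (n - j) (by omega) ?_
    have : (f ^ (n - j)) ((f ^ j) x) = y := by
      rw [← mul_apply, ← pow_add, Nat.sub_add_cancel hjn, hny]
    rwa [e] at this
  intro hs
  -- The stretch from `f x` to `y` is closed under the product, because `y` now goes to `f x`; it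
  -- does not contain `x`.
  have := hs.symm.mem_of_mapsTo (S := {z | ∃ j, 0 < j ∧ j ≤ n ∧ z = (f ^ j) x}) ?_
    ⟨n, by omega, le_rfl, hny.symm⟩
  · obtain ⟨j, hj, hjn, e⟩ := this
    exact hnx j hj hjn e.symm
  · rintro a ⟨j, hj, hjn, rfl⟩
    rcases hjn.eq_or_lt with rfl | hlt
    · refine ⟨1, one_pos, hj, ?_⟩
      rw [hny]; simp
    · refine ⟨j + 1, by omega, hlt, ?_⟩
      rw [mul_apply, swap_apply_of_ne_of_ne (hnx j hj hjn) (hmin j hlt), pow_succ', mul_apply]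

/-- Splitting a cycle by a transposition: the old cycles are obtained by merging the new ones. -/
theorem sameCycle_iff_of_split {f : Perm α} {x y : α} (hxy : x ≠ y) (h : f.SameCycle x y)
    {a b : α} :
    f.SameCycle a b ↔ (f * swap x y).SameCycle a b ∨
      ((f * swap x y).SameCycle a x ∨ (f * swap x y).SameCycle a y) ∧
      ((f * swap x y).SameCycle b x ∨ (f * swap x y).SameCycle b y) := by
  have := sameCycle_mul_swap_iff (not_sameCycle_mul_swap hxy h) (a := a) (b := b)
  rwa [mul_assoc, swap_mul_self, mul_one] at this

/-- The class of `y` stands for the merged cycle, so the cycles of `f` other than that of `x` biject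
with the new cycles. -/
theorem numCycles_mul_swap_of_not {f : Perm α} {x y : α} (h : ¬ f.SameCycle x y) :
    numCycles (f * swap x y) + 1 = numCycles f := by
  classical
  set g := f * swap x y with hg
  have hiff := fun a b => sameCycle_mul_swap_iff h (a := a) (b := b)
  let F : {c : Quotient (SameCycle.setoid f) // c ≠ ⟦x⟧} → Quotient (SameCycle.setoid g) :=
    fun c => Quotient.map' (s₁ := SameCycle.setoid f) (s₂ := SameCycle.setoid g) id
      (fun a b hab => (hiff a b).2 (Or.inl hab)) c.1
  have hF : Function.Bijective F := by
    constructor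
    · rintro ⟨c, hc⟩ ⟨d, hd⟩ hcd
      induction c using Quotient.inductionOn with | _ a
      induction d using Quotient.inductionOn with | _ b
      have hab : g.SameCycle a b := Quotient.exact hcd
      have ha : ¬ f.SameCycle a x := fun e => hc (Quotient.sound e)
      have hb : ¬ f.SameCycle b x := fun e => hd (Quotient.sound e)
      apply Subtype.ext
      apply Quotient.sound
      show f.SameCycle a b
      rcases (hiff a b).1 hab with e | ⟨e1, e2⟩
      · exact e
      · exact (e1.resolve_left ha).trans (e2.resolve_left hb).symm
    · intro c
      induction c using Quotient.inductionOn with | _ a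
      by_cases ha : f.SameCycle a x
      · refine ⟨⟨⟦y⟧, fun e => h (Quotient.exact e).symm⟩, ?_⟩
        apply Quotient.sound
        show g.SameCycle y a
        exact (hiff y a).2 (Or.inr ⟨Or.inr (SameCycle.refl _ _), Or.inl ha⟩)
      · exact ⟨⟨⟦a⟧, fun e => ha (Quotient.exact e)⟩, rfl⟩
  have h1 : Nat.card {c : Quotient (SameCycle.setoid f) // c ≠ ⟦x⟧} = numCycles g :=
    Nat.card_eq_of_bijective F hF
  have : Fintype (Quotient (SameCycle.setoid f)) := Fintype.ofFinite _
  have h2 : Nat.card {c : Quotient (SameCycle.setoid f) // c ≠ ⟦x⟧} + 1 = numCycles f := by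
    rw [numCycles, Nat.card_eq_fintype_card, Nat.card_eq_fintype_card,
      Fintype.card_subtype_compl, Fintype.card_subtype_eq]
    have : 0 < Fintype.card (Quotient (SameCycle.setoid f)) := Fintype.card_pos_iff.2 ⟨⟦x⟧⟩
    omega
  omega

theorem numCycles_mul_swap_of_sameCycle {f : Perm α} {x y : α} (hxy : x ≠ y)
    (h : f.SameCycle x y) : numCycles (f * swap x y) = numCycles f + 1 := by
  have := numCycles_mul_swap_of_not (not_sameCycle_mul_swap hxy h)
  rw [mul_assoc, swap_mul_self, mul_one] at this
  exact this.symm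

/-- The parity of the number of cycles is given by the sign. -/
theorem sign_eq_neg_one_pow_numCycles {α : Type*} [Fintype α] [DecidableEq α] (f : Perm α) :
    sign f = (-1) ^ (Fintype.card α + numCycles f) := by
  rw [← Nat.card_eq_fintype_card]
  induction f using swap_induction_on' with
  | one => rw [numCycles_one, sign_one, ← two_mul, pow_mul]; simp
  | mul_swap f x y hxy ih =>
    rw [sign_mul, sign_swap hxy, ih]
    by_cases h : f.SameCycle x y
    · rw [numCycles_mul_swap_of_sameCycle hxy h, ← add_assoc, pow_succ]
    · rw [← numCycles_mul_swap_of_not h, ← add_assoc, pow_succ]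
      simp

end Cycles

end Equiv.Perm

/-! ### Gaps of a set on a cycle, each named by the element that closes it. -/

namespace Equiv.Perm

section Hit

variable {α : Type*}

open Classical in
/-- The first element of `S` among `e`, `q e`, `q (q e)`, and so on. -/
noncomputable def hit (q : Perm α) (S : Set α) (e : α) : α :=
  -- The default value does not depend on `e`, so `hit_apply` needs no assumption that `S` is ever
  -- reached.
  if h : ∃ i : ℕ, (q ^ i) e ∈ S then (q ^ Nat.find h) e else Classical.choice ⟨e⟩

theorem hit_of_mem (q : Perm α) {S : Set α} {e : α} (he : e ∈ S) : hit q S e = e := by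
  classical
  have h : ∃ i : ℕ, (q ^ i) e ∈ S := ⟨0, he⟩
  rw [hit, dif_pos h, (Nat.find_eq_zero h).2 he]
  rfl

theorem hit_apply (q : Perm α) {S : Set α} {e : α} (he : e ∉ S) :
    hit q S (q e) = hit q S e := by
  classical
  by_cases h : ∃ i : ℕ, (q ^ i) e ∈ S
  · have h' : ∃ i : ℕ, (q ^ i) (q e) ∈ S := by
      obtain ⟨i, hi⟩ := h
      cases i with
      | zero => exact absurd hi he
      | succ i => exact ⟨i, by rwa [pow_succ, mul_apply] at hi⟩
    have hf : Nat.find h = Nat.find h' + 1 := by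
      refine (Nat.find_eq_iff h).2 ⟨?_, fun n hn => ?_⟩
      · rw [pow_succ, mul_apply]; exact Nat.find_spec h'
      · cases n with
        | zero => exact he
        | succ n =>
          rw [pow_succ, mul_apply]
          exact Nat.find_min h' (by omega)
    rw [hit, hit, dif_pos h, dif_pos h', hf, pow_succ, mul_apply]
  · have h' : ¬ ∃ i : ℕ, (q ^ i) (q e) ∈ S := by
      rintro ⟨i, hi⟩
      exact h ⟨i + 1, by rwa [pow_succ, mul_apply]⟩
    rw [hit, hit, dif_neg h, dif_neg h']

/-- Induction along `q` up to the first element of `S`. -/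
theorem hit_induction [Finite α] {q : Perm α} {S : Set α} {p : α → Prop}
    (base : ∀ e ∈ S, p e) (step : ∀ e ∉ S, p (q e) → p e) {e : α}
    (h : ∃ f ∈ S, q.SameCycle e f) : p e := by
  obtain ⟨f, hf, hef⟩ := h
  obtain ⟨i, rfl⟩ := hef.exists_nat_pow_eq
  clear hef
  induction i generalizing e with
  | zero => exact base _ hf
  | succ i ih =>
    by_cases he : e ∈ S
    · exact base _ he
    · exact step _ he (ih (by rwa [pow_succ, mul_apply] at hf))

theorem hit_mem [Finite α] {q : Perm α} {S : Set α} {e : α} (h : ∃ f ∈ S, q.SameCycle e f) :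
    hit q S e ∈ S := by
  refine hit_induction (q := q) (S := S) (p := fun e => hit q S e ∈ S) ?_ ?_ h
  · intro e he; rwa [hit_of_mem q he]
  · intro e he h; rwa [← hit_apply q he]

/-- A permutation that agrees with `q` off `S` also moves from `e` to its first hit. -/
theorem sameCycle_hit_of_eqOn [Finite α] {q g : Perm α} {S : Set α} (hg : ∀ e ∉ S, g e = q e)
    {e : α} (h : ∃ f ∈ S, q.SameCycle e f) : g.SameCycle e (hit q S e) := by
  refine hit_induction (q := q) (S := S) (p := fun e => g.SameCycle e (hit q S e)) ?_ ?_ h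
  · intro e he; rw [hit_of_mem q he]
  · intro e he h
    rw [← hit_apply q he]
    rw [← hg e he] at h ⊢
    exact (sameCycle_self_apply g e).trans h

theorem sameCycle_hit [Finite α] {q : Perm α} {S : Set α} {e : α}
    (h : ∃ f ∈ S, q.SameCycle e f) : q.SameCycle e (hit q S e) :=
  sameCycle_hit_of_eqOn (fun _ _ => rfl) h

/-- Every hit is the hit of an element that follows immediately after an element of `S`. -/
theorem exists_hit_apply_eq [Finite α] {q : Perm α} {S : Set α} {e : α}
    (h : ∃ f ∈ S, q.SameCycle e f) :
    ∃ a ∈ S, q.SameCycle e a ∧ hit q S (q a) = hit q S e := by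
  have h' : ∃ f ∈ S, q⁻¹.SameCycle (q⁻¹ e) f := by
    obtain ⟨f, hf, hef⟩ := h
    refine ⟨f, hf, ?_⟩
    rw [sameCycle_inv]
    exact ((sameCycle_self_apply q (q⁻¹ e)).trans (by simpa using hef))
  have key := hit_induction (q := q⁻¹) (S := S)
    (p := fun f => ∃ a ∈ S, q.SameCycle f a ∧ hit q S (q a) = hit q S (q f)) ?_ ?_ h'
  · obtain ⟨a, ha, h1, h2⟩ := key
    refine ⟨a, ha, ?_, by simpa using h2⟩
    have := (sameCycle_self_apply q (q⁻¹ e)).symm.trans h1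
    simpa using this
  · intro f hf; exact ⟨f, hf, SameCycle.refl _ _, rfl⟩
  · rintro f hf ⟨a, ha, h1, h2⟩
    refine ⟨a, ha, ?_, ?_⟩
    · have := (sameCycle_self_apply q (q⁻¹ f)).symm.trans h1
      simpa using this
    · rw [h2, hit_apply q hf]; simp

/-- The first-return map of `S` is surjective, hence injective by finiteness. So only one element of
`S` opens a given gap. -/
theorem hit_apply_injOn [Finite α] {q : Perm α} {S : Set α} {a b : α} (ha : a ∈ S) (hb : b ∈ S)
    (h : hit q S (q a) = hit q S (q b)) : a = b := by
  have hm : ∀ a : S, hit q S (q a) ∈ S := fun a =>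
    hit_mem ⟨a, a.2, (sameCycle_self_apply q a).symm⟩
  let φ : S → S := fun a => ⟨hit q S (q a), hm a⟩
  have hφ : Function.Surjective φ := by
    rintro ⟨s, hs⟩
    obtain ⟨a, ha, -, h2⟩ := exists_hit_apply_eq (q := q) (S := S) ⟨s, hs, SameCycle.refl _ _⟩
    exact ⟨⟨a, ha⟩, Subtype.ext (h2.trans (hit_of_mem q hs))⟩
  have := Finite.injective_iff_surjective.2 hφ
  exact congrArg Subtype.val (@this ⟨a, ha⟩ ⟨b, hb⟩ (Subtype.ext h))

/-- Either the way from `f` to its first hit in `S` avoids `T`, or it visits `T` before. -/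
theorem hit_hit_or [Finite α] {q : Perm α} {S T : Set α} {f : α}
    (h : ∃ s ∈ S, q.SameCycle f s) :
    (hit q T f = hit q T (hit q S f) ∧ (f ∈ S ∨ f ∉ T)) ∨
      ∃ f' ∈ T, q.SameCycle f f' ∧ hit q S f' = hit q S f := by
  refine hit_induction (q := q) (S := S) (p := fun f =>
    (hit q T f = hit q T (hit q S f) ∧ (f ∈ S ∨ f ∉ T)) ∨
      ∃ f' ∈ T, q.SameCycle f f' ∧ hit q S f' = hit q S f) ?_ ?_ h
  · intro e he; left; rw [hit_of_mem q he]; exact ⟨rfl, Or.inl he⟩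
  · intro e he ih
    by_cases heT : e ∈ T
    · right; exact ⟨e, heT, SameCycle.refl _ _, rfl⟩
    · rw [hit_apply q he, hit_apply q heT] at ih
      rcases ih with ⟨h1, -⟩ | ⟨f', h1, h2, h3⟩
      · left; exact ⟨h1, Or.inr heT⟩
      · right; exact ⟨f', h1, (sameCycle_self_apply q e).trans h2, h3⟩

/-- The gap before an element `ρ` of `S` in its cycle can be cut off by a transposition. -/
theorem exists_swap_sameCycle_iff_hit_eq [Finite α] [DecidableEq α] {q : Perm α} {S : Set α}
    {ρ σ : α} (hρ : ρ ∈ S) (hσ : σ ∈ S) (hρσ : q.SameCycle ρ σ) (hne : σ ≠ ρ) :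
    ∃ a ∈ S, a ≠ ρ ∧ q.SameCycle ρ a ∧
      ∀ e, q.SameCycle ρ e → ((q * swap a ρ).SameCycle e ρ ↔ hit q S e = ρ) := by
  obtain ⟨a, ha, hρa, hhit⟩ := exists_hit_apply_eq (q := q) (S := S) ⟨ρ, hρ, SameCycle.refl _ _⟩
  rw [hit_of_mem q hρ] at hhit
  have haρ : a ≠ ρ := by
    rintro rfl
    -- If `ρ` were its own predecessor in `S`, its gap would be the whole cycle and contain `σ`.
    have := hρσ.mem_of_mapsTo (S := {e | hit q S e = a}) ?_ (hit_of_mem q hρ)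
    · exact hne ((hit_of_mem q hσ).symm.trans this)
    · intro e he
      by_cases heS : e ∈ S
      · have : e = a := (hit_of_mem q heS).symm.trans he
        rw [this]; exact hhit
      · exact (hit_apply q heS).trans he
  refine ⟨a, ha, haρ, hρa, fun e he => ⟨fun h => ?_, fun h => ?_⟩⟩
  · refine h.symm.mem_of_mapsTo (S := {e | hit q S e = ρ}) ?_ (hit_of_mem q hρ)
    intro e he
    by_cases heS : e ∈ S
    · have : e = ρ := (hit_of_mem q heS).symm.trans he
      subst this
      simpa using hhit
    · have h1 : e ≠ a := fun e' => heS (e' ▸ ha)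
      have h2 : e ≠ ρ := fun e' => heS (e' ▸ hρ)
      show hit q S ((q * swap a ρ) e) = ρ
      rw [mul_apply, swap_apply_of_ne_of_ne h1 h2]
      exact (hit_apply q heS).trans he
  · have := sameCycle_hit_of_eqOn (q := q) (g := q * swap a ρ) (S := S) (fun e heS => by
      have h1 : e ≠ a := fun e' => heS (e' ▸ ha)
      have h2 : e ≠ ρ := fun e' => heS (e' ▸ hρ)
      rw [mul_apply, swap_apply_of_ne_of_ne h1 h2]) ⟨ρ, hρ, he.symm⟩
    rwa [h] at this

/-- Elements of a split cycle with different hits in a set containing the transposed elements,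
if these hits are the transposed elements, are separated. -/
theorem not_sameCycle_mul_swap_hit [Finite α] [DecidableEq α] {q : Perm α} {S : Set α}
    {e f : α} (he : ∃ s ∈ S, q.SameCycle e s) (hf : ∃ s ∈ S, q.SameCycle f s)
    (hef : q.SameCycle e f) (hne : hit q S e ≠ hit q S f) :
    ¬ (q * swap (hit q S e) (hit q S f)).SameCycle e f := by
  have hg : ∀ a ∉ S, (q * swap (hit q S e) (hit q S f)) a = q a := fun a ha => by
    have h1 : a ≠ hit q S e := fun e' => ha (e' ▸ hit_mem he)
    have h2 : a ≠ hit q S f := fun e' => ha (e' ▸ hit_mem hf)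
    rw [mul_apply, swap_apply_of_ne_of_ne h1 h2]
  intro h
  exact not_sameCycle_mul_swap hne
    ((sameCycle_hit he).symm.trans (hef.trans (sameCycle_hit hf)))
    ((sameCycle_hit_of_eqOn hg he).symm.trans (h.trans (sameCycle_hit_of_eqOn hg hf)))

end Hit

end Equiv.Perm

/-! ### Tracings, and surgery by 3-cycles inside a fibre. -/

namespace Equiv.Perm

section Tracing

variable {α V : Type*} {t : α → V} {P q : Perm α}

/-- The permutations `q = P * r` where the cycles of `r` are the fibres of `t`. -/
def IsTracing (t : α → V) (P q : Perm α) : Prop :=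
  ∀ a b, (P⁻¹ * q).SameCycle a b ↔ t a = t b

/-- The tracings with the least number of cycles. -/
def IsMinTracing (t : α → V) (P q : Perm α) : Prop :=
  IsTracing t P q ∧ ∀ q', IsTracing t P q' → numCycles q ≤ numCycles q'

/-- The cycle of `a` visits the fibre over `v`. -/
def Touches (t : α → V) (q : Perm α) (v : V) (a : α) : Prop :=
  ∃ e, t e = v ∧ q.SameCycle a e

theorem Touches.congr {v : V} {a b : α} (h : Touches t q v a) (hab : q.SameCycle a b) :
    Touches t q v b :=
  let ⟨e, he, hae⟩ := h
  ⟨e, he, hab.symm.trans hae⟩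

theorem touches_self (t : α → V) (q : Perm α) (a : α) : Touches t q (t a) a :=
  ⟨a, rfl, SameCycle.refl _ _⟩

/-- Some two consecutive elements for `q` lie over `u` and `v`. -/
def Linked (t : α → V) (q : Perm α) (u v : V) : Prop :=
  ∃ e, (t e = u ∧ t (q e) = v) ∨ (t e = v ∧ t (q e) = u)

theorem Linked.symm {u v : V} (h : Linked t q u v) : Linked t q v u :=
  let ⟨e, he⟩ := h
  ⟨e, he.symm⟩

/-- `P⁻¹ * q` permutes every fibre, so each step `e ↦ P e` is a step of `q` from some element of the
fibre of `e`. Thus the links of `P` survive every surgery. -/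
theorem IsTracing.linked (hq : IsTracing t P q) {u v : V} (h : Linked t P u v) :
    Linked t q u v := by
  have key : ∀ e, ∃ e', t e' = t e ∧ q e' = P e := fun e =>
    ⟨(P⁻¹ * q)⁻¹ e, (hq _ _).1 (by
      simpa using sameCycle_self_apply (P⁻¹ * q) ((P⁻¹ * q)⁻¹ e)), by simp⟩
  obtain ⟨e, he⟩ := h
  obtain ⟨e', h1, h2⟩ := key e
  exact ⟨e', by rwa [h1, h2]⟩

variable [Finite α] [DecidableEq α]

theorem sameCycle_of_mul_swap {f : Perm α} {x y a b : α} (hxy : x ≠ y) (h : f.SameCycle x y)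
    (hab : (f * swap x y).SameCycle a b) : f.SameCycle a b :=
  (sameCycle_iff_of_split hxy h).2 (Or.inl hab)

theorem sameCycle_mul_swap_or {f : Perm α} {x y a : α} (hxy : x ≠ y) (h : f.SameCycle x y)
    (ha : f.SameCycle a x) : (f * swap x y).SameCycle a x ∨ (f * swap x y).SameCycle a y := by
  rcases (sameCycle_iff_of_split hxy h).1 ha with h | h
  · exact Or.inl h
  · exact h.1

theorem sameCycle_mul_swap_iff_of_not {f : Perm α} {x y a b : α} (hxy : x ≠ y)
    (h : f.SameCycle x y) (ha : ¬ f.SameCycle a x) :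
    (f * swap x y).SameCycle a b ↔ f.SameCycle a b := by
  refine ⟨sameCycle_of_mul_swap hxy h, fun hab => ?_⟩
  rcases (sameCycle_iff_of_split hxy h).1 hab with h' | ⟨h1 | h1, -⟩
  · exact h'
  · exact absurd (sameCycle_of_mul_swap hxy h h1) ha
  · exact absurd ((sameCycle_of_mul_swap hxy h h1).trans h.symm) ha

/-- The first transposition splits a cycle; as `z` is on the side of `x`, the second one rejoins the
same two parts. -/
theorem sameCycle_mul_swap_mul_swap_iff {f : Perm α} {x y z : α} (hxy : x ≠ y)
    (h : f.SameCycle x y) (hz : (f * swap x y).SameCycle z x) {a b : α} :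
    (f * swap x y * swap y z).SameCycle a b ↔ f.SameCycle a b := by
  have hyz : ¬ (f * swap x y).SameCycle y z := fun e =>
    not_sameCycle_mul_swap hxy h (e.trans hz).symm
  have hc : ∀ c, (f * swap x y).SameCycle c z ↔ (f * swap x y).SameCycle c x :=
    fun c => ⟨fun e => e.trans hz, fun e => e.trans hz.symm⟩
  rw [sameCycle_mul_swap_iff hyz, sameCycle_iff_of_split hxy h, hc, hc,
    or_comm (a := SameCycle _ a y), or_comm (a := SameCycle _ b y)]

/-- Elements of one fibre: a suitable orientation of a 3-cycle gives a tracing again. The first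
element `x` depends on `z` only. -/
theorem IsTracing.exists_first (hq : IsTracing t P q) {S : Set α} (hS : S.Nonempty) {z : α}
    (hSz : ∀ s ∈ S, t s = t z) :
    ∃ x ∈ S, ∀ y ∈ S, y ≠ x → IsTracing t P (q * swap x y * swap y z) := by
  set r := P⁻¹ * q with hr
  have hz : ∃ s ∈ S, r.SameCycle z s := by
    obtain ⟨s, hs⟩ := hS
    exact ⟨s, hs, (hq _ _).2 (hSz s hs).symm⟩
  -- Since `x` is the first element of `S` after `z`, a split at `x` and any `y` leaves `z` on the
  -- side of `x`.
  refine ⟨hit r S z, hit_mem hz, fun y hy hne => ?_⟩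
  have hx := hit_mem hz
  set x := hit r S z with hxdef
  have hxy : r.SameCycle x y := (hq _ _).2 ((hSz x hx).trans (hSz y hy).symm)
  have hzx : (r * swap x y).SameCycle z x := sameCycle_hit_of_eqOn (fun e he => by
    have h1 : e ≠ x := fun e' => he (e' ▸ hx)
    have h2 : e ≠ y := fun e' => he (e' ▸ hy)
    rw [mul_apply, swap_apply_of_ne_of_ne h1 h2]) hz
  intro a b
  rw [← hq a b, ← sameCycle_mul_swap_mul_swap_iff hne.symm hxy hzx, hr]
  simp only [mul_assoc]

/-- Which orientation of the 3-cycle works depends on the order of `x`, `y`, `z` around the vertex,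
so `s` cannot be prescribed. -/
theorem IsTracing.exists_swap (hq : IsTracing t P q) {x y z : α} (hxy : x ≠ y)
    (hx : t x = t z) (hy : t y = t z) :
    ∃ s, (s = x ∨ s = y) ∧ IsTracing t P (q * swap x y * swap s z) := by
  obtain ⟨x', hx', h⟩ := hq.exists_first (S := {x, y}) ⟨x, Or.inl rfl⟩ (z := z)
    (by rintro s (rfl | rfl) <;> assumption)
  rcases hx' with rfl | rfl
  · exact ⟨y, Or.inr rfl, h y (Or.inr rfl) hxy.symm⟩
  · refine ⟨x, Or.inl rfl, ?_⟩
    have := h x (Or.inl rfl) hxy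
    rwa [swap_comm] at this

/-- In a minimal tracing, the elements of a fibre lie in at most two cycles. -/
theorem IsMinTracing.false_of_three (hq : IsMinTracing t P q) {x y z : α} (hx : t x = t z)
    (hy : t y = t z) (hxy : ¬ q.SameCycle x y) (hxz : ¬ q.SameCycle x z)
    (hyz : ¬ q.SameCycle y z) : False := by
  have hne : x ≠ y := fun e => hxy (e ▸ SameCycle.refl _ _)
  obtain ⟨s, hs, ht⟩ := hq.1.exists_swap hne hx hy
  have h1 := numCycles_mul_swap_of_not hxy
  have hsz : ¬ (q * swap x y).SameCycle s z := by
    rw [sameCycle_mul_swap_iff hxy]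
    rintro (h | ⟨-, h | h⟩)
    · rcases hs with rfl | rfl
      · exact hxz h
      · exact hyz h
    · exact hxz h.symm
    · exact hyz h.symm
  have h2 := numCycles_mul_swap_of_not hsz
  have h3 := hq.2 _ ht
  omega

/-- The result of splitting a cycle by a transposition and merging one part with another cycle. -/
structure IsSplit (q q' : Perm α) (x y s z : α) : Prop where
  ne : x ≠ y
  same : q.SameCycle x y
  not_same : ¬ q.SameCycle x z
  mem : s = x ∨ s = y
  eq : q' = q * swap x y * swap s z

namespace IsSplit

variable {q' : Perm α} {x y s z : α}

theorem sameCycle_left (h : IsSplit q q' x y s z) : q.SameCycle x s := by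
  rcases h.mem with rfl | rfl
  · exact SameCycle.refl _ _
  · exact h.same

theorem not_sameCycle_half (h : IsSplit q q' x y s z) : ¬ (q * swap x y).SameCycle s z := fun e =>
  h.not_same (h.sameCycle_left.trans (sameCycle_of_mul_swap h.ne h.same e))

theorem sameCycle_of_half (h : IsSplit q q' x y s z) {a b : α}
    (hab : (q * swap x y).SameCycle a b) : q'.SameCycle a b := by
  rw [h.eq, sameCycle_mul_swap_iff h.not_sameCycle_half]
  exact Or.inl hab

/-- The merge only brings in the cycle of `z`, so within the old cycle of `x` just the split is
visible. -/
theorem sameCycle_iff_half (h : IsSplit q q' x y s z) {a b : α} (ha : q.SameCycle a x)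
    (hb : q.SameCycle b x) : q'.SameCycle a b ↔ (q * swap x y).SameCycle a b := by
  refine ⟨fun hab => ?_, h.sameCycle_of_half⟩
  have hz : ∀ c, q.SameCycle c x → ¬ (q * swap x y).SameCycle c z := fun c hc e =>
    h.not_same (hc.symm.trans (sameCycle_of_mul_swap h.ne h.same e))
  rw [h.eq, sameCycle_mul_swap_iff h.not_sameCycle_half] at hab
  rcases hab with hab | ⟨h1, h2⟩
  · exact hab
  · exact (h1.resolve_right (hz a ha)).trans (h2.resolve_right (hz b hb)).symm

theorem not_sameCycle (h : IsSplit q q' x y s z) : ¬ q'.SameCycle x y := by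
  rw [h.sameCycle_iff_half (SameCycle.refl _ _) h.same.symm]
  exact not_sameCycle_mul_swap h.ne h.same

theorem sameCycle_or (h : IsSplit q q' x y s z) {a : α} (ha : q.SameCycle a x) :
    q'.SameCycle a x ∨ q'.SameCycle a y :=
  (sameCycle_mul_swap_or h.ne h.same ha).imp h.sameCycle_of_half h.sameCycle_of_half

theorem sameCycle_iff (h : IsSplit q q' x y s z) {a b : α} (hax : ¬ q.SameCycle a x)
    (haz : ¬ q.SameCycle a z) : q'.SameCycle a b ↔ q.SameCycle a b := by
  have hz : ¬ (q * swap x y).SameCycle a z := fun e => haz (sameCycle_of_mul_swap h.ne h.same e)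
  have hs : ¬ (q * swap x y).SameCycle a s := fun e =>
    hax ((sameCycle_of_mul_swap h.ne h.same e).trans h.sameCycle_left.symm)
  rw [h.eq, sameCycle_mul_swap_iff h.not_sameCycle_half,
    sameCycle_mul_swap_iff_of_not h.ne h.same hax]
  tauto

theorem sameCycle_merged (h : IsSplit q q' x y s z) {a : α} (ha : q.SameCycle a z) :
    q'.SameCycle a s := by
  have hax : ¬ q.SameCycle a x := fun e => h.not_same (e.symm.trans ha)
  rw [h.eq, sameCycle_mul_swap_iff h.not_sameCycle_half]
  exact Or.inr ⟨Or.inr ((sameCycle_mul_swap_iff_of_not h.ne h.same hax).2 ha),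
    Or.inl (SameCycle.refl _ _)⟩

/-- One split and one merge leave the number of cycles unchanged. -/
theorem isMinTracing (h : IsSplit q q' x y s z) (hq : IsMinTracing t P q)
    (hq' : IsTracing t P q') : IsMinTracing t P q' := by
  refine ⟨hq', fun p hp => ?_⟩
  have h1 := numCycles_mul_swap_of_sameCycle h.ne h.same
  have h2 := numCycles_mul_swap_of_not h.not_sameCycle_half
  rw [← h.eq] at h2
  have := hq.2 p hp
  omega

end IsSplit

theorem IsMinTracing.exists_isSplit (hq : IsMinTracing t P q) {x y z : α} (hxy : x ≠ y)
    (hx : t x = t z) (hy : t y = t z) (h : q.SameCycle x y) (hz : ¬ q.SameCycle x z) :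
    ∃ q' s, IsMinTracing t P q' ∧ IsSplit q q' x y s z := by
  obtain ⟨s, hs, ht⟩ := hq.1.exists_swap hxy hx hy
  have hsp : IsSplit q (q * swap x y * swap s z) x y s z := ⟨hxy, h, hz, hs, rfl⟩
  exact ⟨_, s, hsp.isMinTracing hq ht, hsp⟩

/-- Two fibres that meet a common cycle and different further cycles do not cross on the common
cycle. -/
theorem IsMinTracing.sameCycle_mul_swap (hq : IsMinTracing t P q) {x y z c d w : α}
    (hxy : x ≠ y) (hx : t x = t z) (hy : t y = t z) (h : q.SameCycle x y)
    (hz : ¬ q.SameCycle x z) (hc : t c = t w) (hd : t d = t w) (hcx : q.SameCycle c x)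
    (hdx : q.SameCycle d x) (hwx : ¬ q.SameCycle w x) (hwz : ¬ q.SameCycle w z) :
    (q * swap x y).SameCycle c d := by
  obtain ⟨q', s, hq', hsp⟩ := hq.exists_isSplit hxy hx hy h hz
  by_contra hcd
  -- If `c` and `d` were separated, their fibre would meet three cycles after the surgery.
  refine hq'.false_of_three hc hd ?_ ?_ ?_
  · rwa [hsp.sameCycle_iff_half hcx hdx]
  · rw [sameCycle_comm, hsp.sameCycle_iff hwx hwz]
    exact fun e => hwx (e.trans hcx)
  · rw [sameCycle_comm, hsp.sameCycle_iff hwx hwz]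
    exact fun e => hwx (e.trans hdx)

/-- A fibre that meets the cycles of `a` and `b`, and another fibre that meets the cycles of `a`
and `c`: on the cycle of `a`, the second one lies in one gap of the first one. -/
theorem IsMinTracing.hit_eq_hit (hq : IsMinTracing t P q) {u w : V} {a b c e f : α}
    (hua : Touches t q u a) (hub : Touches t q u b) (hwc : Touches t q w c)
    (hab : ¬ q.SameCycle a b) (hac : ¬ q.SameCycle a c) (hbc : ¬ q.SameCycle b c)
    (he : t e = w) (hf : t f = w) (hae : q.SameCycle a e) (haf : q.SameCycle a f) :
    hit q (t ⁻¹' {u}) e = hit q (t ⁻¹' {u}) f := by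
  obtain ⟨a', ha', haa'⟩ := hua
  obtain ⟨b', hb', hbb'⟩ := hub
  obtain ⟨c', hc', hcc'⟩ := hwc
  have hE : ∃ s ∈ t ⁻¹' {u}, q.SameCycle e s := ⟨a', ha', hae.symm.trans haa'⟩
  have hF : ∃ s ∈ t ⁻¹' {u}, q.SameCycle f s := ⟨a', ha', haf.symm.trans haa'⟩
  by_contra hne
  refine not_sameCycle_mul_swap_hit hE hF (hae.symm.trans haf) hne ?_
  have h1 := sameCycle_hit hE
  have h2 := sameCycle_hit hF
  have hm1 : t (hit q (t ⁻¹' {u}) e) = u := hit_mem hE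
  have hm2 : t (hit q (t ⁻¹' {u}) f) = u := hit_mem hF
  refine hq.sameCycle_mul_swap (z := b') (w := c') hne (hm1.trans hb'.symm) (hm2.trans hb'.symm)
    (h1.symm.trans (hae.symm.trans (haf.trans h2))) ?_ (he.trans hc'.symm) (hf.trans hc'.symm) h1
    (haf.symm.trans (hae.trans h1)) ?_ ?_
  · exact fun h => hab (hae.trans (h1.trans (h.trans hbb'.symm)))
  · exact fun h => hac (hae.trans (h1.trans (h.symm.trans hcc'.symm)))
  · exact fun h => hbc (hbb'.trans (h.symm.trans hcc'.symm))

/-- A fibre that meets the cycles of `a` and `b` meets no other cycle. -/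
theorem IsMinTracing.sameCycle_or (hq : IsMinTracing t P q) {v : V} {a b e : α}
    (ha : Touches t q v a) (hb : Touches t q v b) (hab : ¬ q.SameCycle a b) (he : t e = v) :
    q.SameCycle a e ∨ q.SameCycle b e := by
  obtain ⟨a', ha', haa'⟩ := ha
  obtain ⟨b', hb', hbb'⟩ := hb
  by_contra! h
  exact hq.false_of_three (ha'.trans he.symm) (hb'.trans he.symm)
    (fun e => hab (haa'.trans (e.trans hbb'.symm))) (fun e => h.1 (haa'.trans e))
    (fun e => h.2 (hbb'.trans e))

theorem IsMinTracing.not_touches (hq : IsMinTracing t P q) {v : V} {a b c : α}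
    (ha : Touches t q v a) (hb : Touches t q v b) (hab : ¬ q.SameCycle a b)
    (hac : ¬ q.SameCycle a c) (hbc : ¬ q.SameCycle b c) : ¬ Touches t q v c := by
  rintro ⟨e, he, hce⟩
  rcases hq.sameCycle_or ha hb hab he with h | h
  · exact hac (h.trans hce.symm)
  · exact hbc (h.trans hce.symm)

end Tracing

/-! ### Counting the fibres seen through one gap. -/

section Gap

variable {α V : Type*} [Finite α] {t : α → V} {P q : Perm α}

/-- A vertex is linked to few vertices that meet it in a single gap only. -/
theorem IsTracing.ncard_gap_le [Finite V] (hq : IsTracing t P q) {m : ℕ} {y : V} {ρ : α}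
    {Q : Set V} (hm : {v | v ≠ y ∧ ¬ Linked t P y v}.ncard ≤ m) (hyQ : y ∉ Q)
    (hQ : ∀ e, t e ∈ Q → t (q e) = y ∨ t (q⁻¹ e) = y → hit q (t ⁻¹' {y}) e = ρ) :
    Q.ncard ≤ m + 2 := by
  classical
  -- `b` is the fibre of the first element of the gap closed by `ρ`; the value `y` is a default.
  obtain ⟨b, hb⟩ : ∃ b, ∀ f, t f = y → hit q (t ⁻¹' {y}) (q f) = ρ → t (q f) = b := by
    by_cases h : ∃ f, t f = y ∧ hit q (t ⁻¹' {y}) (q f) = ρ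
    · obtain ⟨f, hf, hfρ⟩ := h
      refine ⟨t (q f), fun f' hf' hfρ' => ?_⟩
      rw [hit_apply_injOn (S := t ⁻¹' {y}) hf' hf (hfρ'.trans hfρ.symm)]
    · exact ⟨y, fun f hf hfρ => absurd ⟨f, hf, hfρ⟩ h⟩
  -- Inside this gap only its first element and the predecessor of `ρ` are next to an element over
  -- `y`.
  have hsub : Q ⊆ {v | v ≠ y ∧ ¬ Linked t P y v} ∪ {t (q⁻¹ ρ), b} := by
    intro z hz
    have hzy : z ≠ y := fun e => hyQ (e ▸ hz)
    by_cases hl : Linked t P y z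
    · right
      obtain ⟨e, ⟨h1, h2⟩ | ⟨h1, h2⟩⟩ := hq.linked hl
      · right
        rw [← h2]
        exact hb e h1 (hQ _ (h2 ▸ hz) (Or.inr (by simpa using h1)))
      · left
        have h3 := hQ e (h1 ▸ hz) (Or.inl h2)
        rw [← hit_apply q (show e ∉ t ⁻¹' {y} from fun h => hzy (h1.symm.trans h)),
          hit_of_mem q (show q e ∈ t ⁻¹' {y} from h2)] at h3
        rw [← h1, ← h3]; simp
    · exact Or.inl ⟨hzy, hl⟩
  calc Q.ncard ≤ _ := Set.ncard_le_ncard hsub (Set.toFinite _)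
    _ ≤ _ := Set.ncard_union_le _ _
    _ ≤ m + 2 := add_le_add hm
      ((Set.ncard_insert_le _ _).trans (by rw [Set.ncard_singleton]))

end Gap

end Equiv.Perm

/-! ### Leaves: an extremal choice among non-crossing fibres. -/

namespace Equiv.Perm

section Leaf

variable {α V : Type*} [Finite α] [DecidableEq α] [Finite V] {t : α → V} {P q : Perm α} {m : ℕ}

theorem exists_sameCycle_of_linked {y : V} {e : α} (h : t (q e) = y ∨ t (q⁻¹ e) = y) :
    ∃ f, t f = y ∧ q.SameCycle e f := by
  rcases h with h | h
  · exact ⟨_, h, sameCycle_self_apply q e⟩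
  · refine ⟨_, h, ?_⟩
    have := (sameCycle_self_apply q (q⁻¹ e)).symm
    simpa using this

/-- If a cycle is met by fibres that meet different further cycles, then one of these fibres
sees all those with another further cycle in one of its gaps. -/
theorem IsMinTracing.exists_leaf (hq : IsMinTracing t P q) {a b₀ c₀ : α} {x₀ w₀ : V}
    (hxa : Touches t q x₀ a) (hxb : Touches t q x₀ b₀) (hwa : Touches t q w₀ a)
    (hwc : Touches t q w₀ c₀) (hab : ¬ q.SameCycle a b₀) (hac : ¬ q.SameCycle a c₀)
    (hbc : ¬ q.SameCycle b₀ c₀) :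
    ∃ y b ρ, Touches t q y a ∧ Touches t q y b ∧ ¬ q.SameCycle a b ∧
      ∀ e c, Touches t q (t e) c → ¬ q.SameCycle a c → ¬ q.SameCycle b c → q.SameCycle a e →
        hit q (t ⁻¹' {y}) e = ρ := by
  classical
  -- The gap of `x` that contains `f` is to be minimal; the leaf will be `t f`.
  have hex : ∃ n, ∃ x b c f, Touches t q x a ∧ Touches t q x b ∧ Touches t q (t f) c ∧
      ¬ q.SameCycle a b ∧ ¬ q.SameCycle a c ∧ ¬ q.SameCycle b c ∧ q.SameCycle a f ∧
      {e | q.SameCycle a e ∧ t e ≠ x ∧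
        hit q (t ⁻¹' {x}) e = hit q (t ⁻¹' {x}) f}.ncard = n := by
    obtain ⟨f, hf, haf⟩ := hwa
    exact ⟨_, x₀, b₀, c₀, f, hxa, hxb, hf ▸ hwc, hab, hac, hbc, haf, rfl⟩
  obtain ⟨x, b, c, f, hxa, hxb, hyc, hab, hac, hbc, haf, hcard⟩ := Nat.find_spec hex
  have hmin := fun k => Nat.find_min hex (m := k)
  rw [← hcard] at hmin
  obtain ⟨x', hx', hax'⟩ := id hxa
  have hya : Touches t q (t f) a := ⟨f, rfl, haf⟩
  have hys : ∀ e, q.SameCycle a e → ∃ s ∈ t ⁻¹' {t f}, q.SameCycle e s := fun e he =>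
    ⟨f, rfl, he.symm.trans haf⟩
  have hyx : t f ≠ x := fun e => hq.not_touches hxa hxb hab hac hbc (e ▸ hyc)
  refine ⟨t f, c, hit q (t ⁻¹' {t f}) x', hya, hyc, hac, fun e d hd had hcd hae => ?_⟩
  by_contra hσ
  -- The gap of `t f` around `e` does not contain `x`, so it lies in the chosen gap of `x`; its
  -- closing element, which is over `t f`, no longer counts.
  refine hmin _ ?_ ⟨t f, c, d, e, hya, hyc, hd, hac, had, hcd, hae, rfl⟩
  have hσm : t (hit q (t ⁻¹' {t f}) e) = t f := hit_mem (hys e hae)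
  have hσa : q.SameCycle a (hit q (t ⁻¹' {t f}) e) := hae.trans (sameCycle_hit (hys e hae))
  have hσx : hit q (t ⁻¹' {x}) (hit q (t ⁻¹' {t f}) e) = hit q (t ⁻¹' {x}) f :=
    hq.hit_eq_hit hxa hxb hyc hab hac hbc hσm rfl hσa haf
  refine Set.ncard_lt_ncard ?_ (Set.toFinite _)
  refine Set.ssubset_iff_exists.2 ⟨?_, ⟨hit q (t ⁻¹' {t f}) e, ⟨hσa, ?_, hσx⟩, fun h => h.2.1 hσm⟩⟩
  · rintro g ⟨hag, hgy, hgσ⟩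
    rcases hit_hit_or (T := t ⁻¹' {x}) (hys g hag) with ⟨h1, h2⟩ | ⟨g', h1, h2, h3⟩
    · refine ⟨hag, h2.resolve_left hgy, ?_⟩
      rw [h1, hgσ, hσx]
    · exfalso
      apply hσ
      rw [← hgσ, ← h3]
      exact hq.hit_eq_hit hya hyc hxb hac hab (fun h => hbc h.symm) h1 hx' (hag.trans h2) hax'
  · rw [hσm]; exact hyx

/-- At most one of the further cycles is met by many of the fibres that meet a given cycle. -/
theorem IsMinTracing.ncard_le_or (hq : IsMinTracing t P q)
    (hm : ∀ y, {v | v ≠ y ∧ ¬ Linked t P y v}.ncard ≤ m) {a b c : α}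
    (hab : ¬ q.SameCycle a b) (hac : ¬ q.SameCycle a c) (hbc : ¬ q.SameCycle b c) :
    {v | Touches t q v a ∧ Touches t q v b}.ncard ≤ m + 2 ∨
      {v | Touches t q v a ∧ Touches t q v c}.ncard ≤ m + 2 := by
  rcases Set.eq_empty_or_nonempty {v | Touches t q v a ∧ Touches t q v b} with h | ⟨x, hxa, hxb⟩
  · left; rw [h]; simp
  rcases Set.eq_empty_or_nonempty {v | Touches t q v a ∧ Touches t q v c} with h | ⟨w, hwa, hwc⟩
  · right; rw [h]; simp
  obtain ⟨y, d, ρ, hya, hyd, had, hρ⟩ := hq.exists_leaf hxa hxb hwa hwc hab hac hbc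
  have key : ∀ c, ¬ q.SameCycle a c → ¬ q.SameCycle d c →
      {v | Touches t q v a ∧ Touches t q v c}.ncard ≤ m + 2 := by
    intro c hac hdc
    refine hq.1.ncard_gap_le (hm y) (ρ := ρ) (fun h => hq.not_touches hya hyd had hac hdc h.2) ?_
    rintro e ⟨hea, hec⟩ he
    obtain ⟨f, hf, hef⟩ := exists_sameCycle_of_linked he
    refine hρ e c hec hac hdc ?_
    rcases hq.sameCycle_or hea hec hac rfl with h | h
    · exact h
    · rcases hq.sameCycle_or hya hyd had hf with h' | h'
      · exact h'.trans hef.symm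
      · exact absurd (h'.trans (hef.symm.trans h.symm)) hdc
  by_cases hdb : q.SameCycle d b
  · right
    exact key c hac fun h => hbc (hdb.symm.trans h)
  · left
    exact key b hab hdb

end Leaf

/-! ### The grid bound. -/

section Grid

/-- A set whose elements are related only within rows and columns is small if rows, columns, and
the sets of non-related elements are small. -/
theorem ncard_grid_le {V ι κ : Type*} [Finite V] {E : Set V} {row : V → ι} {col : V → κ}
    {R : V → V → Prop} {m : ℕ} (hm : ∀ x, {v | v ≠ x ∧ ¬ R x v}.ncard ≤ m)
    (hR : ∀ x ∈ E, ∀ y ∈ E, R x y → row x = row y ∨ col x = col y)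
    (hrow : ∀ x ∈ E, {y ∈ E | row y = row x}.ncard ≤ m + 2)
    (hcol : ∀ x ∈ E, {y ∈ E | col y = col x}.ncard ≤ m + 2) : E.ncard ≤ 3 * m + 2 := by
  classical
  rcases E.eq_empty_or_nonempty with rfl | ⟨x, hx⟩
  · simp
  have h1 := Set.ncard_inter_add_ncard_sdiff_eq_ncard E {y | row y = row x} (Set.toFinite _)
  have h2 := Set.ncard_inter_add_ncard_sdiff_eq_ncard (E ∩ {y | row y = row x})
    {y | col y = col x} (Set.toFinite _)
  have h3 := Set.ncard_inter_add_ncard_sdiff_eq_ncard (E \ {y | row y = row x})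
    {y | col y = col x} (Set.toFinite _)
  have hO : ((E \ {y | row y = row x}) \ {y | col y = col x}).ncard ≤ m := by
    refine (Set.ncard_le_ncard ?_ (Set.toFinite _)).trans (hm x)
    rintro y ⟨⟨hy, h1⟩, h2⟩
    refine ⟨fun e => h1 (e ▸ rfl), fun h => ?_⟩
    rcases hR x hx y hy h with h | h
    · exact h1 h.symm
    · exact h2 h.symm
  have hr : (E ∩ {y | row y = row x}).ncard ≤ m + 2 := hrow x hx
  have hc : ((E \ {y | row y = row x}) ∩ {y | col y = col x}).ncard ≤ m + 2 :=
    (Set.ncard_le_ncard (t := {y ∈ E | col y = col x}) (fun y hy => ⟨hy.1.1, hy.2⟩)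
      (Set.toFinite _)).trans (hcol x hx)
  -- If the row of `x` leaves the column of `x` at `y`, then `y` is unrelated to the rest of that
  -- column. Otherwise the column contains the row.
  rcases Set.eq_empty_or_nonempty ((E ∩ {y | row y = row x}) \ {y | col y = col x}) with
    h | ⟨y, ⟨hy, hy1⟩, hy2⟩
  · have hc' : ((E \ {y | row y = row x}) ∩ {y | col y = col x}).ncard +
        ((E ∩ {y | row y = row x}) ∩ {y | col y = col x}).ncard ≤ m + 2 := by
      rw [← Set.ncard_union_eq _ (Set.toFinite _) (Set.toFinite _)]
      · refine (Set.ncard_le_ncard ?_ (Set.toFinite _)).trans (hcol x hx)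
        rintro y (hy | hy)
        · exact ⟨hy.1.1, hy.2⟩
        · exact ⟨hy.1.1, hy.2⟩
      · refine Set.disjoint_left.2 fun y h1 h2 => h1.1.2 h2.1.2
    rw [h, Set.ncard_empty] at h2
    omega
  · have hK : ((E \ {y | row y = row x}) ∩ {y | col y = col x}).ncard ≤ m := by
      refine (Set.ncard_le_ncard ?_ (Set.toFinite _)).trans (hm y)
      rintro z ⟨⟨hz, hz1⟩, hz2⟩
      have e1 : row y ≠ row z := fun e => hz1 (e.symm.trans hy1)
      have e2 : col y ≠ col z := fun e => hy2 (e.trans hz2)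
      refine ⟨fun e => e1 (e ▸ rfl), fun h => ?_⟩
      exact (hR y hy z hz h).elim e1 e2
    omega

end Grid

/-! ### Three cycles that pairwise meet a common fibre. -/

section Triangle

variable {α V : Type*} [Finite α] [DecidableEq α] [Finite V] {t : α → V} {P q : Perm α} {m : ℕ}

theorem IsMinTracing.exists_hit_eq (hq : IsMinTracing t P q) {u w : V} {a b c : α}
    (hua : Touches t q u a) (hub : Touches t q u b) (hwa : Touches t q w a)
    (hwc : Touches t q w c) (hab : ¬ q.SameCycle a b) (hac : ¬ q.SameCycle a c)
    (hbc : ¬ q.SameCycle b c) :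
    ∃ ρ, t ρ = u ∧ q.SameCycle a ρ ∧
      ∀ e, t e = w → q.SameCycle a e → hit q (t ⁻¹' {u}) e = ρ := by
  obtain ⟨f, hf, haf⟩ := hwa
  obtain ⟨s, hs, has⟩ := id hua
  have h : ∃ s ∈ t ⁻¹' {u}, q.SameCycle f s := ⟨s, hs, haf.symm.trans has⟩
  exact ⟨hit q (t ⁻¹' {u}) f, hit_mem h, haf.trans (sameCycle_hit h),
    fun e he hae => hq.hit_eq_hit hua hub hwc hab hac hbc he hf hae haf⟩

/-- Fibres that meet a given pair of cycles and a fixed gap of a fibre that meets one of them. -/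
theorem IsMinTracing.ncard_row_le (hq : IsMinTracing t P q)
    (hm : ∀ y, {v | v ≠ y ∧ ¬ Linked t P y v}.ncard ≤ m) {a b : α} {w : V} {ρ : α}
    (hab : ¬ q.SameCycle a b) (hwb : ¬ Touches t q w b) {Q : Set V}
    (hQ : ∀ v ∈ Q, Touches t q v a ∧ Touches t q v b)
    (hρ : ∀ e, t e ∈ Q → q.SameCycle a e → hit q (t ⁻¹' {w}) e = ρ) : Q.ncard ≤ m + 2 := by
  refine hq.1.ncard_gap_le (hm w) (ρ := ρ) (fun h => hwb (hQ w h).2) fun e he hl => ?_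
  obtain ⟨f, hf, hef⟩ := exists_sameCycle_of_linked hl
  refine hρ e he ?_
  rcases hq.sameCycle_or (hQ _ he).1 (hQ _ he).2 hab rfl with h | h
  · exact h
  · exact absurd ⟨f, hf, h.trans hef⟩ hwb

/-- If any two of three cycles meet a common fibre, then the number of fibres that meet two given
ones is bounded. -/
theorem IsMinTracing.ncard_le_of_triangle (hq : IsMinTracing t P q)
    (hm : ∀ y, {v | v ≠ y ∧ ¬ Linked t P y v}.ncard ≤ m) {a b c : α} {v w : V}
    (hab : ¬ q.SameCycle a b) (hac : ¬ q.SameCycle a c) (hbc : ¬ q.SameCycle b c)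
    (hwa : Touches t q w a) (hwc : Touches t q w c) (hvb : Touches t q v b)
    (hvc : Touches t q v c) :
    {v | Touches t q v a ∧ Touches t q v b}.ncard ≤ 3 * m + 2 := by
  have hcb : ¬ q.SameCycle c b := fun h => hbc h.symm
  have hca : ¬ q.SameCycle c a := fun h => hac h.symm
  have hba : ¬ q.SameCycle b a := fun h => hab h.symm
  have hr : ∀ x, ∃ ρ, Touches t q x a → Touches t q x b → ∀ e, t e = x → q.SameCycle a e →
      hit q (t ⁻¹' {w}) e = ρ := by
    intro x
    by_cases h : Touches t q x a ∧ Touches t q x b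
    · obtain ⟨ρ, -, -, hρ⟩ := hq.exists_hit_eq hwa hwc h.1 h.2 hac hab hcb
      exact ⟨ρ, fun _ _ => hρ⟩
    · obtain ⟨e, -⟩ := hwa
      exact ⟨e, fun h1 h2 => absurd ⟨h1, h2⟩ h⟩
  have hc : ∀ x, ∃ ρ, Touches t q x a → Touches t q x b → ∀ e, t e = x → q.SameCycle b e →
      hit q (t ⁻¹' {v}) e = ρ := by
    intro x
    by_cases h : Touches t q x a ∧ Touches t q x b
    · obtain ⟨ρ, -, -, hρ⟩ := hq.exists_hit_eq hvb hvc h.2 h.1 hbc hba hca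
      exact ⟨ρ, fun _ _ => hρ⟩
    · obtain ⟨e, -⟩ := hvb
      exact ⟨e, fun h1 h2 => absurd ⟨h1, h2⟩ h⟩
  choose row hrow using hr
  choose col hcol using hc
  have hwb : ¬ Touches t q w b := hq.not_touches hwa hwc hac hab hcb
  have hva : ¬ Touches t q v a := hq.not_touches hvb hvc hbc hba hca
  refine ncard_grid_le (R := Linked t P) (row := row) (col := col) hm ?_ ?_ ?_
  · rintro x ⟨hxa, hxb⟩ y ⟨hya, hyb⟩ hxy
    -- Rows are gaps of `w` on the cycle of `a`, columns are gaps of `v` on the cycle of `b`. A step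
    -- of `q` between such fibres stays in one cycle and starts off `w` and `v`, so it stays in a
    -- gap.
    have key : ∀ e, Touches t q (t e) a → Touches t q (t e) b → Touches t q (t (q e)) a →
        Touches t q (t (q e)) b → row (t e) = row (t (q e)) ∨ col (t e) = col (t (q e)) := by
      intro e h1 h2 h3 h4
      rcases hq.sameCycle_or h1 h2 hab rfl with h | h
      · left
        rw [← hrow _ h1 h2 e rfl h, ← hrow _ h3 h4 (q e) rfl (h.trans (sameCycle_self_apply q e)),
          hit_apply q (fun e' : e ∈ t ⁻¹' {w} => hwb ((show t e = w from e') ▸ h2))]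
      · right
        rw [← hcol _ h1 h2 e rfl h, ← hcol _ h3 h4 (q e) rfl (h.trans (sameCycle_self_apply q e)),
          hit_apply q (fun e' : e ∈ t ⁻¹' {v} => hva ((show t e = v from e') ▸ h1))]
    obtain ⟨e, ⟨rfl, rfl⟩ | ⟨rfl, rfl⟩⟩ := hq.1.linked hxy
    · exact key e hxa hxb hya hyb
    · exact (key e hya hyb hxa hxb).imp Eq.symm Eq.symm
  · rintro x ⟨hxa, hxb⟩
    refine hq.ncard_row_le hm hab hwb (w := w) (ρ := row x) (fun y hy => hy.1) ?_
    rintro e ⟨⟨h1, h2⟩, h3⟩ hae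
    rw [← h3]; exact hrow _ h1 h2 e rfl hae
  · rintro x ⟨hxa, hxb⟩
    refine hq.ncard_row_le hm hba hva (w := v) (ρ := col x) (fun y hy => hy.1.symm) ?_
    rintro e ⟨⟨h1, h2⟩, h3⟩ hae
    rw [← h3]; exact hcol _ h1 h2 e rfl hae

end Triangle

end Equiv.Perm

/-! ### Balanced cuts of a cycle. -/

namespace Equiv.Perm

section Position

variable {α : Type*} [Finite α] {q : Perm α} {b e y : α}

/-- The least positive number of steps from `b` to `e`. -/
noncomputable def position (q : Perm α) (b e : α) : ℕ :=
  sInf {i : ℕ | 0 < i ∧ (q ^ i) b = e}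

theorem position_spec (h : q.SameCycle b e) :
    0 < position q b e ∧ (q ^ position q b e) b = e := by
  obtain ⟨i, hi, -, h⟩ := h.exists_pow_eq''
  exact Nat.sInf_mem (s := {i : ℕ | 0 < i ∧ (q ^ i) b = e}) ⟨i, hi, h⟩

theorem position_le {i : ℕ} (hi : 0 < i) (h : (q ^ i) b = e) : position q b e ≤ i :=
  Nat.sInf_le ⟨hi, h⟩

theorem position_apply_le (h : q.SameCycle b e) : position q b (q e) ≤ position q b e + 1 :=
  position_le (Nat.succ_pos _) (by rw [pow_succ', mul_apply, (position_spec h).2])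

/-- Steps are counted from one, so `b` itself comes last on its cycle. -/
theorem position_lt_position_self (h : q.SameCycle b e) (hne : e ≠ b) :
    position q b e < position q b b := by
  by_contra! hle
  obtain ⟨h1, h2⟩ := position_spec h
  obtain ⟨h3, h4⟩ := position_spec (SameCycle.refl q b)
  rcases hle.eq_or_lt with h5 | h5
  · rw [← h5, h4] at h2; exact hne h2.symm
  · have h6 : (q ^ (position q b e - position q b b)) ((q ^ position q b b) b) = e := by
      rw [← mul_apply, ← pow_add, Nat.sub_add_cancel h5.le, h2]
    rw [h4] at h6
    have := position_le (by omega) h6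
    omega

/-- The part containing `y` is the stretch from `q b` to `y`, because the product sends `y` to `q
b`. -/
theorem sameCycle_mul_swap_iff_position_le [DecidableEq α] (hby : q.SameCycle b y) (hne : y ≠ b)
    (hbe : q.SameCycle b e) :
    (q * swap b y).SameCycle e y ↔ position q b e ≤ position q b y := by
  have hT : ∀ a ∈ {e | q.SameCycle b e ∧ position q b e ≤ position q b y},
      (q * swap b y) a ∈ {e | q.SameCycle b e ∧ position q b e ≤ position q b y} := by
    rintro a ⟨h1, h2⟩
    have hab : a ≠ b := by
      rintro rfl
      exact absurd (position_lt_position_self hby hne) (not_lt.2 h2)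
    by_cases hay : a = y
    · subst hay
      rw [mul_apply, swap_apply_right]
      exact ⟨sameCycle_self_apply q b, (position_le one_pos (pow_one q ▸ rfl)).trans
        (position_spec hby).1⟩
    · rw [mul_apply, swap_apply_of_ne_of_ne hab hay]
      refine ⟨h1.trans (sameCycle_self_apply q a), (position_apply_le h1).trans ?_⟩
      refine Nat.succ_le_of_lt (lt_of_le_of_ne h2 fun h => hay ?_)
      rw [← (position_spec h1).2, h, (position_spec hby).2]
  constructor
  · exact fun h => (h.symm.mem_of_mapsTo hT ⟨hby, le_rfl⟩).2
  · intro h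
    refine (sameCycle_mul_swap_or hne.symm hby hbe.symm).resolve_left fun h' => ?_
    exact absurd (h'.mem_of_mapsTo hT ⟨hbe, h⟩).2
      (not_le.2 (position_lt_position_self hby hne))

end Position

section Threshold

/-- Each level adds at most `g` elements, so the first level that reaches `K` overshoots by less
than `g`. -/
theorem exists_threshold {V : Type*} [Finite V] {Z : Set V} (p : V → ℕ) {g K : ℕ}
    (hg : ∀ z ∈ Z, {x ∈ Z | p x = p z}.ncard ≤ g) (hK : 0 < K) (hZ : K ≤ Z.ncard) :
    ∃ z ∈ Z, K ≤ {x ∈ Z | p x ≤ p z}.ncard ∧ {x ∈ Z | p x ≤ p z}.ncard < K + g := by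
  classical
  have hex : ∃ n, K ≤ {x ∈ Z | p x ≤ n}.ncard := by
    obtain ⟨n, hn⟩ := (Set.toFinite (p '' Z)).bddAbove
    refine ⟨n, hZ.trans (Set.ncard_le_ncard (fun x hx => ⟨hx, hn ⟨x, hx, rfl⟩⟩) (Set.toFinite _))⟩
  obtain ⟨n, hn, hmin⟩ : ∃ n, K ≤ {x ∈ Z | p x ≤ n}.ncard ∧ {x ∈ Z | p x < n}.ncard < K := by
    refine ⟨Nat.find hex, Nat.find_spec hex, ?_⟩
    rcases h : Nat.find hex with _ | n
    · simpa using hK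
    · have := Nat.find_min hex (m := n) (by omega)
      simpa [Nat.lt_succ_iff] using this
  have hsplit : {x ∈ Z | p x ≤ n} = {x ∈ Z | p x < n} ∪ {x ∈ Z | p x = n} := by
    ext x
    simp only [Set.mem_ofPred_eq, Set.mem_union, le_iff_lt_or_eq]
    tauto
  have hle := Set.ncard_union_le {x ∈ Z | p x < n} {x ∈ Z | p x = n}
  rw [← hsplit] at hle
  obtain ⟨z, hz, rfl⟩ : {x ∈ Z | p x = n}.Nonempty := by
    rw [Set.nonempty_iff_ne_empty]
    intro h
    rw [h, Set.ncard_empty] at hle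
    omega
  refine ⟨z, hz, hn, ?_⟩
  have := hg z hz
  omega

end Threshold

section Union

variable {α V : Type*} [Finite α] [DecidableEq α] [Finite V] {t : α → V} {P q : Perm α} {m : ℕ}

/-- Otherwise the cycle of `b` can be cut at `v`, and one part merged with the cycle of `c`, so that
both resulting cycles share at least `m + 3` fibres with the cycle of `a`. This contradicts
`IsMinTracing.ncard_le_or`. -/
theorem IsMinTracing.ncard_add_ncard_le (hq : IsMinTracing t P q)
    (hm : ∀ y, {v | v ≠ y ∧ ¬ Linked t P y v}.ncard ≤ m) {a b c : α} {v : V}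
    (hab : ¬ q.SameCycle a b) (hac : ¬ q.SameCycle a c) (hbc : ¬ q.SameCycle b c)
    (hvb : Touches t q v b) (hvc : Touches t q v c)
    (hle : {v | Touches t q v a ∧ Touches t q v c}.ncard ≤ m + 2) :
    {v | Touches t q v a ∧ Touches t q v b}.ncard +
      {v | Touches t q v a ∧ Touches t q v c}.ncard ≤ 3 * m + 6 := by
  by_contra! hlt
  have hcb : ¬ q.SameCycle c b := fun h => hbc h.symm
  have hca : ¬ q.SameCycle c a := fun h => hac h.symm
  have hba : ¬ q.SameCycle b a := fun h => hab h.symm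
  have hva : ¬ Touches t q v a := hq.not_touches hvb hvc hbc hba hca
  obtain ⟨z, hz, hcz⟩ := id hvc
  obtain ⟨b', hb', hbb'⟩ := id hvb
  -- The cut element `b₁` does not depend on the other one, which can therefore be found by a
  -- threshold.
  obtain ⟨b₁, ⟨hb₁, hbb₁⟩, hfirst⟩ := hq.1.exists_first (S := {e | t e = v ∧ q.SameCycle b e})
    ⟨b', hb', hbb'⟩ (z := z) (fun s hs => hs.1.trans hz.symm)
  set Z := {v | Touches t q v a ∧ Touches t q v b} with hZ
  set W := {v | Touches t q v a ∧ Touches t q v c} with hW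
  have hr : ∀ x, ∃ ρ, t ρ = v ∧ q.SameCycle b ρ ∧ (x ∈ Z → ∀ e, t e = x → q.SameCycle b e →
      hit q (t ⁻¹' {v}) e = ρ) := by
    intro x
    by_cases h : x ∈ Z
    · obtain ⟨ρ, h1, h2, hρ⟩ := hq.exists_hit_eq hvb hvc h.2 h.1 hbc hba hca
      exact ⟨ρ, h1, h2, fun _ => hρ⟩
    · exact ⟨b', hb', hbb', fun h' => absurd h' h⟩
  choose ρ hρv hρb hρ using hr
  have hρ₁ : ∀ x, q.SameCycle b₁ (ρ x) := fun x => hbb₁.symm.trans (hρb x)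
  -- A gap of `v` holds at most `m + 2` fibres of `Z`. So the part merged with `c` gets between `m +
  -- 3` and `2 * m + 4` fibres, those of `W` included, and at least `m + 3` of the `3 * m + 7`
  -- remain.
  obtain ⟨z₀, hz₀, hK1, hK2⟩ := exists_threshold (Z := Z) (fun x => position q b₁ (ρ x))
    (g := m + 2) (K := m + 3 - W.ncard) (by
      intro x hx
      refine hq.ncard_row_le hm hba hva (w := v) (ρ := ρ x) (fun y hy => hy.1.symm) ?_
      rintro e ⟨h1, h2⟩ hbe
      rw [hρ _ h1 e rfl hbe, ← (position_spec (hρ₁ (t e))).2, ← (position_spec (hρ₁ x)).2]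
      exact congrArg (fun i => (q ^ i) b₁) h2) (by omega) (by omega)
  have hsum := Set.ncard_inter_add_ncard_sdiff_eq_ncard Z
    {x | position q b₁ (ρ x) ≤ position q b₁ (ρ z₀)} (Set.toFinite _)
  have hinter : {x ∈ Z | position q b₁ (ρ x) ≤ position q b₁ (ρ z₀)} =
    Z ∩ {x | position q b₁ (ρ x) ≤ position q b₁ (ρ z₀)} := rfl
  rw [← hinter] at hsum
  have hne : ρ z₀ ≠ b₁ := by
    intro h
    have hempty : Z \ {x | position q b₁ (ρ x) ≤ position q b₁ (ρ z₀)} = ∅ := by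
      refine Set.eq_empty_of_forall_notMem fun x hx => hx.2 ?_
      show position q b₁ (ρ x) ≤ position q b₁ (ρ z₀)
      rw [h]
      by_cases hx : ρ x = b₁
      · rw [hx]
      · exact (position_lt_position_self (hρ₁ x) hx).le
    rw [hempty, Set.ncard_empty] at hsum
    omega
  have hsp : IsSplit q (q * swap b₁ (ρ z₀) * swap (ρ z₀) z) b₁ (ρ z₀) (ρ z₀) z :=
    ⟨hne.symm, hρ₁ z₀, fun h => hbc (hbb₁.trans (h.trans hcz.symm)), Or.inr rfl, rfl⟩
  have hq' := hsp.isMinTracing hq (hfirst (ρ z₀) ⟨hρv z₀, hρb z₀⟩ hne)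
  set q' := q * swap b₁ (ρ z₀) * swap (ρ z₀) z with hq'def
  have ha1 : ¬ q.SameCycle a b₁ := fun h => hab (h.trans hbb₁.symm)
  have haz : ¬ q.SameCycle a z := fun h => hac (h.trans hcz.symm)
  have haiff : ∀ e, q'.SameCycle a e ↔ q.SameCycle a e := fun e => hsp.sameCycle_iff ha1 haz
  have htouch : ∀ x, Touches t q x a → Touches t q' x a := by
    rintro x ⟨e, he, hae⟩
    exact ⟨e, he, (haiff e).2 hae⟩
  have hcorner : ∀ x ∈ Z, ∃ e, t e = x ∧ q.SameCycle e b₁ ∧ q'.SameCycle e (ρ x) := by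
    rintro x hx
    obtain ⟨e, he, hbe⟩ := hx.2
    refine ⟨e, he, hbe.symm.trans hbb₁, hsp.sameCycle_of_half ?_⟩
    rw [← hρ x hx e he hbe]
    refine sameCycle_hit_of_eqOn (fun d hd => ?_) ⟨b', hb', hbe.symm.trans hbb'⟩
    have h1 : d ≠ b₁ := fun h => hd (h ▸ hb₁)
    have h2 : d ≠ ρ z₀ := fun h => hd (h ▸ hρv z₀)
    rw [mul_apply, swap_apply_of_ne_of_ne h1 h2]
  have hpos : ∀ x, q'.SameCycle (ρ x) (ρ z₀) ↔
      position q b₁ (ρ x) ≤ position q b₁ (ρ z₀) := fun x => by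
    rw [hsp.sameCycle_iff_half (hρ₁ x).symm (hρ₁ z₀).symm,
      sameCycle_mul_swap_iff_position_le (hρ₁ z₀) hne (hρ₁ x)]
  rcases hq'.ncard_le_or hm (a := a) (b := b₁) (c := ρ z₀) (fun h => ha1 ((haiff _).1 h))
    (fun h => ha1 (((haiff _).1 h).trans (hρ₁ z₀).symm)) hsp.not_sameCycle with h | h
  · have : (Z \ {x | position q b₁ (ρ x) ≤ position q b₁ (ρ z₀)}).ncard ≤ m + 2 := by
      refine (Set.ncard_le_ncard ?_ (Set.toFinite _)).trans h
      rintro x ⟨hx, hx'⟩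
      obtain ⟨e, he, heb, hee⟩ := hcorner x hx
      refine ⟨htouch x hx.1, e, he, ?_⟩
      refine ((hsp.sameCycle_or heb).resolve_right fun h => hx' ?_).symm
      exact (hpos x).1 (hee.symm.trans h)
    omega
  · have : {x ∈ Z | position q b₁ (ρ x) ≤ position q b₁ (ρ z₀)}.ncard + W.ncard ≤ m + 2 := by
      rw [← Set.ncard_union_eq _ (Set.toFinite _) (Set.toFinite _)]
      · refine (Set.ncard_le_ncard ?_ (Set.toFinite _)).trans h
        rintro x (⟨hx, hx'⟩ | hx)
        · obtain ⟨e, he, heb, hee⟩ := hcorner x hx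
          exact ⟨htouch x hx.1, e, he, (hee.trans ((hpos x).2 hx')).symm⟩
        · obtain ⟨e, he, hce⟩ := hx.2
          exact ⟨htouch x hx.1, e, he, (hsp.sameCycle_merged (hce.symm.trans hcz)).symm⟩
      · refine Set.disjoint_left.2 fun x hx hx' => ?_
        exact hq.not_touches hx.1.1 hx.1.2 hab hac hbc hx'.2
    omega

/-- If a fibre meets two cycles, then the number of fibres that meet a third one and one of these
is bounded. -/
theorem IsMinTracing.ncard_union_le (hq : IsMinTracing t P q)
    (hm : ∀ y, {v | v ≠ y ∧ ¬ Linked t P y v}.ncard ≤ m) {a b c : α} {v : V}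
    (hab : ¬ q.SameCycle a b) (hac : ¬ q.SameCycle a c) (hbc : ¬ q.SameCycle b c)
    (hvb : Touches t q v b) (hvc : Touches t q v c) :
    {v | Touches t q v a ∧ (Touches t q v b ∨ Touches t q v c)}.ncard ≤ 3 * m + 6 := by
  have hU : {v | Touches t q v a ∧ (Touches t q v b ∨ Touches t q v c)} =
      {v | Touches t q v a ∧ Touches t q v b} ∪ {v | Touches t q v a ∧ Touches t q v c} := by
    ext x; simp only [Set.mem_ofPred_eq, Set.mem_union]; tauto
  rw [hU]
  refine (Set.ncard_union_le _ _).trans ?_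
  rcases hq.ncard_le_or hm hab hac hbc with h | h
  · rw [add_comm]
    exact hq.ncard_add_ncard_le hm hac hab (fun h => hbc h.symm) hvc hvb h
  · exact hq.ncard_add_ncard_le hm hab hac hbc hvb hvc h

end Union

end Equiv.Perm

/-! ### A cycle that meets all fibres. -/

namespace Equiv.Perm

section Star

variable {α V : Type*} [Finite α] [DecidableEq α] [Finite V] {t : α → V} {P q : Perm α} {m : ℕ}

/-- The vertices without a common cycle with `x` are not linked to `x`. -/
theorem IsTracing.ncard_le_of_disjoint (hq : IsTracing t P q) (ht : Function.Surjective t)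
    (hm : ∀ y, {v | v ≠ y ∧ ¬ Linked t P y v}.ncard ≤ m) {x : V} {S : Set V}
    (hS : ∀ v ∈ S, ∀ a, Touches t q x a → ¬ Touches t q v a) : S.ncard ≤ m := by
  refine (Set.ncard_le_ncard ?_ (Set.toFinite _)).trans (hm x)
  intro v hv
  refine ⟨?_, fun hl => ?_⟩
  · rintro rfl
    obtain ⟨e, rfl⟩ := ht v
    exact hS _ hv e (touches_self t q e) (touches_self t q e)
  · obtain ⟨e, ⟨rfl, rfl⟩ | ⟨rfl, rfl⟩⟩ := hq.linked hl
    · exact hS _ hv e (touches_self t q e) ⟨q e, rfl, sameCycle_self_apply q e⟩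
    · exact hS _ hv e ⟨q e, rfl, sameCycle_self_apply q e⟩ (touches_self t q e)

/-- A vertex with empty fibre is linked to nothing. -/
theorem surjective_of_linked (hn : m + 2 ≤ Nat.card V)
    (hm : ∀ y, {v | v ≠ y ∧ ¬ Linked t P y v}.ncard ≤ m) : Function.Surjective t := by
  intro v
  by_contra hv
  have : ({v}ᶜ : Set V) ⊆ {w | w ≠ v ∧ ¬ Linked t P v w} := by
    refine fun w hw => ⟨hw, ?_⟩
    rintro ⟨e, ⟨h, -⟩ | ⟨-, h⟩⟩
    · exact hv ⟨_, h⟩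
    · exact hv ⟨_, h⟩
  have h1 := (Set.ncard_le_ncard this (Set.toFinite _)).trans (hm v)
  have h2 := Set.ncard_add_ncard_compl ({v} : Set V) (Set.toFinite _) (Set.toFinite _)
  rw [Set.ncard_singleton] at h2
  omega

theorem card_le_of_forall_or {S T U : Set V} (h : ∀ v, v ∈ S ∨ v ∈ T ∨ v ∈ U) :
    Nat.card V ≤ S.ncard + T.ncard + U.ncard := by
  have : S ∪ T ∪ U = _root_.Set.univ := Set.eq_univ_of_forall fun v => by
    rcases h v with h | h | h
    · exact Or.inl (Or.inl h)
    · exact Or.inl (Or.inr h)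
    · exact Or.inr h
  rw [← Set.ncard_univ, ← this]
  exact (Set.ncard_union_le _ _).trans (Nat.add_le_add_right (Set.ncard_union_le _ _) _)

/-- If some fibre is contained in the cycle of `a`, then the cycle of `a` meets all fibres. -/
theorem IsMinTracing.touches_of_pure (hq : IsMinTracing t P q)
    (hm : ∀ y, {v | v ≠ y ∧ ¬ Linked t P y v}.ncard ≤ m) (hn : 5 * m + 7 ≤ Nat.card V)
    (hk : 3 ≤ numCycles q) {x : V} {a : α} (hx : ∀ b, Touches t q x b → q.SameCycle a b) (y : V) :
    Touches t q y a := by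
  have ht : Function.Surjective t := surjective_of_linked (by omega) hm
  by_contra hya
  obtain ⟨b, rfl⟩ := ht y
  have hyb := touches_self t q b
  have hab : ¬ q.SameCycle a b := fun h => hya (hyb.congr h.symm)
  have h1 : {v | ¬ Touches t q v a}.ncard ≤ m :=
    hq.1.ncard_le_of_disjoint ht hm (x := x) fun v hv c hc hvc => hv (hvc.congr (hx c hc).symm)
  -- If so, sets of sizes at most `m`, `m` and `3 * m + 6` cover `V`. If not, at least `n - 2 * m`
  -- fibres meet both `a` and `b`, too many in the presence of a third cycle.
  by_cases hc : ∃ c, Touches t q (t b) c ∧ ¬ q.SameCycle b c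
  · obtain ⟨c, hyc, hbc⟩ := hc
    have hac : ¬ q.SameCycle a c := fun h => hya (hyc.congr h.symm)
    have h2 : {v | ¬ (Touches t q v b ∨ Touches t q v c)}.ncard ≤ m := by
      refine hq.1.ncard_le_of_disjoint ht hm (x := t b) ?_
      rintro v hv d ⟨e, he, hde⟩ hvd
      rcases hq.sameCycle_or hyb hyc hbc he with h | h
      · exact hv (Or.inl (hvd.congr (hde.trans h.symm)))
      · exact hv (Or.inr (hvd.congr (hde.trans h.symm)))
    have h3 := hq.ncard_union_le hm hab hac hbc hyb hyc
    have := card_le_of_forall_or (V := V) (S := {v | ¬ Touches t q v a})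
      (T := {v | ¬ (Touches t q v b ∨ Touches t q v c)})
      (U := {v | Touches t q v a ∧ (Touches t q v b ∨ Touches t q v c)}) (fun v => by
        simp only [Set.mem_ofPred_eq]; tauto)
    omega
  · push Not at hc
    have h2 : {v | ¬ Touches t q v b}.ncard ≤ m :=
      hq.1.ncard_le_of_disjoint ht hm (x := t b) fun v hv c hyc hvc =>
        hv (hvc.congr (hc c hyc).symm)
    have h3 := card_le_of_forall_or (V := V) (S := {v | ¬ Touches t q v a})
      (T := {v | ¬ Touches t q v b}) (U := {v | Touches t q v a ∧ Touches t q v b}) (fun v => by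
        simp only [Set.mem_ofPred_eq]; tauto)
    obtain ⟨c, hac, hbc⟩ := exists_three_of_three_le_numCycles hk a b
    have hwc := touches_self t q c
    by_cases hw : Touches t q (t c) a
    · have := hq.ncard_union_le hm (fun h => hab h.symm) hbc hac hw hwc
      have h4 : {v | Touches t q v a ∧ Touches t q v b}.ncard ≤ _ :=
        Set.ncard_le_ncard (t := {v | Touches t q v b ∧ (Touches t q v a ∨ Touches t q v c)})
          (fun v hv => ⟨hv.2, Or.inl hv.1⟩) (Set.toFinite _)
      omega
    by_cases hw' : Touches t q (t c) b
    · have := hq.ncard_union_le hm hab hac hbc hw' hwc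
      have h4 : {v | Touches t q v a ∧ Touches t q v b}.ncard ≤ _ :=
        Set.ncard_le_ncard (t := {v | Touches t q v a ∧ (Touches t q v b ∨ Touches t q v c)})
          (fun v hv => ⟨hv.1, Or.inl hv.2⟩) (Set.toFinite _)
      omega
    have h4 : {v | Touches t q v a ∧ Touches t q v b}.ncard ≤ m := by
      refine hq.1.ncard_le_of_disjoint ht hm (x := t c) ?_
      rintro v ⟨hva, hvb⟩ d hwd ⟨e, he, hde⟩
      rcases hq.sameCycle_or hva hvb hab he with h | h
      · exact hw (hwd.congr (hde.trans h.symm))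
      · exact hw' (hwd.congr (hde.trans h.symm))
    omega

/-- Let `b` be the further cycle of a leaf `y`. A fibre that misses `b` but is next to `y` meets the
cycle of `a` and, by `hpure`, another one, so `y` sees it in one gap only. -/
theorem IsMinTracing.exists_ncard_not_touches_le (hq : IsMinTracing t P q)
    (hm : ∀ y, {v | v ≠ y ∧ ¬ Linked t P y v}.ncard ≤ m)
    (hpure : ∀ x a, Touches t q x a → ∃ b, Touches t q x b ∧ ¬ q.SameCycle a b) {a b₀ c₀ : α}
    {x₀ w₀ : V} (hxa : Touches t q x₀ a) (hxb : Touches t q x₀ b₀) (hwa : Touches t q w₀ a)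
    (hwc : Touches t q w₀ c₀) (hab : ¬ q.SameCycle a b₀) (hac : ¬ q.SameCycle a c₀)
    (hbc : ¬ q.SameCycle b₀ c₀) :
    ∃ b, ¬ q.SameCycle a b ∧ {v | ¬ Touches t q v b}.ncard ≤ m + 2 := by
  obtain ⟨y, b, ρ, hya, hyb, hab, hρ⟩ := hq.exists_leaf hxa hxb hwa hwc hab hac hbc
  refine ⟨b, hab, hq.1.ncard_gap_le (hm y) (ρ := ρ) (fun h => h hyb) fun e he hl => ?_⟩
  obtain ⟨f, hf, hef⟩ := exists_sameCycle_of_linked hl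
  have heb : ¬ q.SameCycle b e := fun h => he ⟨e, rfl, h⟩
  have hae : q.SameCycle a e :=
    ((hq.sameCycle_or hya hyb hab hf).resolve_right fun h => heb (h.trans hef.symm)).trans hef.symm
  obtain ⟨c, hec, hac⟩ := hpure (t e) a ⟨e, rfl, hae⟩
  exact hρ e c hec hac (fun h => he (hec.congr h.symm)) hae

/-- In a minimal tracing with at least three cycles, one cycle meets all fibres. -/
theorem IsMinTracing.exists_forall_touches (hq : IsMinTracing t P q)
    (hm : ∀ y, {v | v ≠ y ∧ ¬ Linked t P y v}.ncard ≤ m) (hn : 5 * m + 7 ≤ Nat.card V)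
    (hk : 3 ≤ numCycles q) : ∃ a, ∀ v, Touches t q v a := by
  have ht : Function.Surjective t := surjective_of_linked (by omega) hm
  by_contra! hstar
  have hpure : ∀ x a, Touches t q x a → ∃ b, Touches t q x b ∧ ¬ q.SameCycle a b := by
    intro x a hxa
    by_contra! h
    obtain ⟨v, hv⟩ := hstar a
    exact hv (hq.touches_of_pure hm hn hk h v)
  have hcompl : ∀ a, {v | Touches t q v a}.ncard + {v | ¬ Touches t q v a}.ncard = Nat.card V :=
    fun a => Set.ncard_add_ncard_compl _ (Set.toFinite _) (Set.toFinite _)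
  obtain ⟨a, x, w, b, c, hxa, hxb, hwa, hwc, hab, hac, hbc⟩ : ∃ a x w b c, Touches t q x a ∧
      Touches t q x b ∧ Touches t q w a ∧ Touches t q w c ∧ ¬ q.SameCycle a b ∧
      ¬ q.SameCycle a c ∧ ¬ q.SameCycle b c := by
    have : Nonempty V := by
      by_contra h
      rw [not_nonempty_iff] at h
      rw [Nat.card_of_isEmpty] at hn
      omega
    obtain ⟨a, ha⟩ := ht (Classical.arbitrary V)
    have hxa := touches_self t q a
    set x := t a
    obtain ⟨b, hxb, hab⟩ := hpure x a hxa
    obtain ⟨z, hza⟩ := hstar a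
    by_cases hzb : Touches t q z b
    · obtain ⟨c, hzc, hbc⟩ := hpure z b hzb
      exact ⟨b, x, z, a, c, hxb, hxa, hzb, hzc, fun h => hab h.symm, hbc,
        fun h => hza (hzc.congr h.symm)⟩
    have h1 : {v | ∀ a, Touches t q x a → ¬ Touches t q v a}.ncard ≤ m :=
      hq.1.ncard_le_of_disjoint ht hm (x := x) fun v hv => hv
    have h2 : {v | ∀ a, Touches t q z a → ¬ Touches t q v a}.ncard ≤ m :=
      hq.1.ncard_le_of_disjoint ht hm (x := z) fun v hv => hv
    obtain ⟨v, hv1, hv2⟩ : ∃ v, (∃ f, Touches t q x f ∧ Touches t q v f) ∧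
        ∃ g, Touches t q z g ∧ Touches t q v g := by
      by_contra! hcon
      have := card_le_of_forall_or (V := V) (S := {v | ∀ a, Touches t q x a → ¬ Touches t q v a})
        (T := {v | ∀ a, Touches t q z a → ¬ Touches t q v a}) (U := ∅) (fun v => by
          by_cases h : ∃ f, Touches t q x f ∧ Touches t q v f
          · exact Or.inr (Or.inl (hcon v h))
          · push Not at h; exact Or.inl h)
      rw [Set.ncard_empty] at this
      omega
    obtain ⟨f, hxf, hvf⟩ := hv1
    obtain ⟨g, hzg, hvg⟩ := hv2
    have hz : ∀ f, Touches t q x f → ¬ Touches t q z f := by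
      rintro f ⟨e, he, hfe⟩ hzf
      rcases hq.sameCycle_or hxa hxb hab he with h | h
      · exact hza (hzf.congr (hfe.trans h.symm))
      · exact hzb (hzf.congr (hfe.trans h.symm))
    obtain ⟨f', hxf', hff'⟩ := hpure x f hxf
    exact ⟨f, x, v, f', g, hxf, hxf', hvf, hvg, hff', fun h => hz f hxf (hzg.congr h.symm),
      fun h => hz f' hxf' (hzg.congr h.symm)⟩
  -- The leaf argument is used around `a` to find `b`, and then around `b` to find `c`; each is
  -- missed by at most `m + 2` fibres.
  obtain ⟨b, -, hb⟩ := hq.exists_ncard_not_touches_le hm hpure hxa hxb hwa hwc hab hac hbc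
  clear hxa hxb hwa hwc hab hac hbc
  have hbn := hcompl b
  obtain ⟨x, w, c, d, hxb, hxc, hwb, hwd, hbc, hbd, hcd⟩ : ∃ x w c d, Touches t q x b ∧
      Touches t q x c ∧ Touches t q w b ∧ Touches t q w d ∧ ¬ q.SameCycle b c ∧
      ¬ q.SameCycle b d ∧ ¬ q.SameCycle c d := by
    by_contra! hcon
    obtain ⟨x, hxb⟩ : {v | Touches t q v b}.Nonempty := by
      rw [Set.nonempty_iff_ne_empty]
      intro h
      rw [h, Set.ncard_empty] at hbn
      omega
    obtain ⟨c, hxc, hbc⟩ := hpure x b hxb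
    have hall : ∀ w, Touches t q w b → Touches t q w c := by
      intro w hwb
      obtain ⟨d, hwd, hbd⟩ := hpure w b hwb
      exact hwd.congr (hcon x w c d hxb hxc hwb hwd hbc hbd).symm
    obtain ⟨z, hzc⟩ := hstar c
    have h : {v | Touches t q v b}.ncard ≤ m := by
      refine hq.1.ncard_le_of_disjoint ht hm (x := z) ?_
      rintro v hvb f hzf ⟨e, he, hfe⟩
      rcases hq.sameCycle_or hvb (hall v hvb) hbc he with h | h
      · exact hzc (hall z (hzf.congr (hfe.trans h.symm)))
      · exact hzc (hzf.congr (hfe.trans h.symm))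
    omega
  obtain ⟨c, hbc, hc⟩ := hq.exists_ncard_not_touches_le hm hpure hxb hxc hwb hwd hbc hbd hcd
  have hor : ∀ v, v ∈ {v | ¬ Touches t q v b} ∨ v ∈ {v | ¬ Touches t q v c} ∨
      v ∈ {v | Touches t q v b ∧ Touches t q v c} := fun v => by
    simp only [Set.mem_ofPred_eq]; tauto
  have hsum := card_le_of_forall_or hor
  have hcover : ∀ v, ¬ Touches t q v b → Touches t q v c := by
    intro z hzb
    by_contra hzc
    have h : {v | Touches t q v b ∧ Touches t q v c}.ncard ≤ m := by
      refine hq.1.ncard_le_of_disjoint ht hm (x := z) ?_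
      rintro v ⟨hvb, hvc⟩ f hzf ⟨e, he, hfe⟩
      rcases hq.sameCycle_or hvb hvc hbc he with h | h
      · exact hzb (hzf.congr (hfe.trans h.symm))
      · exact hzc (hzf.congr (hfe.trans h.symm))
    omega
  -- If so, the triangle bound gives `n ≤ 2 * (m + 2) + (3 * m + 2)`. If not, fibres missing `b` are
  -- never linked to fibres missing `c`, and `n ≤ 2 * m + (3 * m + 6)`.
  by_cases hD : ∃ y z f, ¬ Touches t q y b ∧ ¬ Touches t q z c ∧ Touches t q y f ∧ Touches t q z f
  · obtain ⟨y, z, f, hyb, hzc, hyf, hzf⟩ := hD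
    have hzb : Touches t q z b := by
      by_contra h; exact hzc (hcover z h)
    have := hq.ncard_le_of_triangle hm (a := b) (b := c) (c := f) hbc
      (fun h => hyb (hyf.congr h.symm)) (fun h => hzc (hzf.congr h.symm)) hzb hzf (hcover y hyb) hyf
    omega
  · push Not at hD
    obtain ⟨y, hyb⟩ := hstar b
    obtain ⟨z, hzc⟩ := hstar c
    have hzb : Touches t q z b := by
      by_contra h; exact hzc (hcover z h)
    have h1 : {v | ¬ Touches t q v b}.ncard ≤ m :=
      hq.1.ncard_le_of_disjoint ht hm (x := z) fun v hv f hzf hvf => hD v z f hv hzc hvf hzf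
    have h2 : {v | ¬ Touches t q v c}.ncard ≤ m :=
      hq.1.ncard_le_of_disjoint ht hm (x := y) fun v hv f hyf => hD y v f hyb hv hyf
    obtain ⟨d, hzd, hbd⟩ := hpure z b hzb
    have h3 := hq.ncard_union_le hm (a := c) (fun h => hbc h.symm)
      (fun h => hzc (hzd.congr h.symm)) hbd hzb hzd
    have h4 : {v | Touches t q v b ∧ Touches t q v c}.ncard ≤ _ :=
      Set.ncard_le_ncard (t := {v | Touches t q v c ∧ (Touches t q v b ∨ Touches t q v d)})
        (fun v hv => ⟨hv.2, Or.inl hv.1⟩) (Set.toFinite _)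
    omega

end Star

end Equiv.Perm

/-! ### Contradiction from a central cycle, and existence of good tracings. -/

namespace Equiv.Perm

section StarContradiction

variable {α V : Type*} [Finite α] [DecidableEq α] [Finite V] {t : α → V} {P q : Perm α} {m : ℕ}

/-- If all minimal tracings have a cycle that meets all fibres, then a fibre that meets the
central cycle and that of `b` has all fibres with another further cycle in one of its gaps. -/
theorem IsMinTracing.exists_main_gap (hq : IsMinTracing t P q)
    (hm : ∀ y, {v | v ≠ y ∧ ¬ Linked t P y v}.ncard ≤ m) (hn : 5 * m + 7 ≤ Nat.card V)
    (hk : 3 ≤ numCycles q) {a b c : α} {w : V} {u : V} (hua : Touches t q u a)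
    (hub : Touches t q u b) (hwa : Touches t q w a) (hwc : Touches t q w c)
    (hab : ¬ q.SameCycle a b) (hac : ¬ q.SameCycle a c) (hbc : ¬ q.SameCycle b c) :
    ∃ ρ, t ρ = u ∧ q.SameCycle a ρ ∧ ∀ e d, Touches t q (t e) d → ¬ q.SameCycle a d →
      ¬ q.SameCycle b d → q.SameCycle a e → hit q (t ⁻¹' {u}) e = ρ := by
  obtain ⟨f, rfl, haf⟩ := hwa
  obtain ⟨a', ha', haa'⟩ := id hua
  obtain ⟨b', hb', hbb'⟩ := id hub
  have hex : ∀ e, q.SameCycle a e → ∃ s ∈ t ⁻¹' {u}, q.SameCycle e s := fun e he =>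
    ⟨a', ha', he.symm.trans haa'⟩
  have hmem : ∀ e, q.SameCycle a e → t (hit q (t ⁻¹' {u}) e) = u := fun e he => hit_mem (hex e he)
  refine ⟨hit q (t ⁻¹' {u}) f, hmem f haf, haf.trans (sameCycle_hit (hex f haf)),
    fun e d hed had hbd hae => ?_⟩
  by_contra hne
  have hae' := hae.trans (sameCycle_hit (hex e hae))
  have haf' := haf.trans (sameCycle_hit (hex f haf))
  obtain ⟨q', s, hq', hsp⟩ := hq.exists_isSplit hne ((hmem e hae).trans hb'.symm)
    ((hmem f haf).trans hb'.symm) (hae'.symm.trans haf')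
    (fun h => hab (hae'.trans (h.trans hbb'.symm)))
  have hg : ∀ d ∉ t ⁻¹' {u},
      (q * swap (hit q (t ⁻¹' {u}) e) (hit q (t ⁻¹' {u}) f)) d = q d := fun d hd => by
    have h1 : d ≠ hit q (t ⁻¹' {u}) e := fun h => hd (h ▸ hmem e hae)
    have h2 : d ≠ hit q (t ⁻¹' {u}) f := fun h => hd (h ▸ hmem f haf)
    rw [mul_apply, swap_apply_of_ne_of_ne h1 h2]
  have he' := hsp.sameCycle_of_half (sameCycle_hit_of_eqOn hg (hex e hae))
  have hf' := hsp.sameCycle_of_half (sameCycle_hit_of_eqOn hg (hex f haf))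
  -- The new central cycle meets `u`, so it is one of the two halves. But `t f` also meets `c` and
  -- misses the half of `e`, while `t e` also meets `d` and misses the half of `f`.
  obtain ⟨g, hstar⟩ := hq'.exists_forall_touches hm hn (hk.trans (hq.2 _ hq'.1))
  have hfar : ∀ d, ¬ q.SameCycle a d → ¬ q.SameCycle b d →
      ∀ x, q'.SameCycle d x ↔ q.SameCycle d x := fun d h1 h2 x =>
    hsp.sameCycle_iff (fun h => h1 (hae'.trans h.symm)) (fun h => h2 (hbb'.trans h.symm))
  have key : ∀ d v x y, ¬ q.SameCycle a d → ¬ q.SameCycle b d → Touches t q v d →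
      q.SameCycle a x → q.SameCycle a y → Touches t q' v x → ¬ q'.SameCycle x y →
      ¬ Touches t q' v y := by
    rintro d v x y had hbd ⟨d', hd', hdd'⟩ hax hay hvx hxy
    refine hq'.not_touches hvx (b := d) ⟨d', hd', ((hfar d had hbd) _).2 hdd'⟩ ?_ hxy ?_
    · rw [sameCycle_comm, hfar d had hbd]
      exact fun h => had (hax.trans h.symm)
    · rw [hfar d had hbd]
      exact fun h => had (hay.trans h.symm)
  obtain ⟨x, hx, hgx⟩ := hstar u
  rcases hq'.sameCycle_or (v := u) ⟨_, hmem e hae, SameCycle.refl _ _⟩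
    ⟨_, hmem f haf, SameCycle.refl _ _⟩ hsp.not_sameCycle hx with h | h
  · exact key c (t f) _ _ hac hbc hwc haf' hae' ⟨f, rfl, hf'.symm⟩
      (fun h' => hsp.not_sameCycle h'.symm) ((hstar _).congr (hgx.trans h.symm))
  · exact key d (t e) _ _ had hbd hed hae' haf' ⟨e, rfl, he'.symm⟩ hsp.not_sameCycle
      ((hstar _).congr (hgx.trans h.symm))

/-- A fibre that crosses a gap of `u` is in only one gap of `w` apart from that. -/
theorem IsMinTracing.hit_eq_hit_of_crossing (hq : IsMinTracing t P q) {u w : V} {a b c ρu ρw : α}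
    (hub : Touches t q u b) (hwc : Touches t q w c)
    (hab : ¬ q.SameCycle a b) (hac : ¬ q.SameCycle a c) (hbc : ¬ q.SameCycle b c) (huw : u ≠ w)
    (hρu : t ρu = u) (hρua : q.SameCycle a ρu) (hρw : t ρw = w) (hρwa : q.SameCycle a ρw)
    (hu : ∀ e, t e = w → q.SameCycle a e → hit q (t ⁻¹' {u}) e = ρu)
    (hw : ∀ e, t e = u → q.SameCycle a e → hit q (t ⁻¹' {w}) e = ρw) {x y z : α}
    (hxz : t x = t z) (hyz : t y = t z) (hax : q.SameCycle a x) (hay : q.SameCycle a y)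
    (haz : q.SameCycle a z) (hx : hit q (t ⁻¹' {u}) x ≠ ρu)
    (hyx : hit q (t ⁻¹' {u}) y ≠ hit q (t ⁻¹' {u}) x)
    (hzx : hit q (t ⁻¹' {u}) z ≠ hit q (t ⁻¹' {u}) x) :
    hit q (t ⁻¹' {w}) y = hit q (t ⁻¹' {w}) z := by
  obtain ⟨b', hb', hbb'⟩ := hub
  obtain ⟨c', hc', hcc'⟩ := hwc
  have hexu : ∀ e, q.SameCycle a e → ∃ s ∈ t ⁻¹' {u}, q.SameCycle e s := fun e he =>
    ⟨ρu, hρu, he.symm.trans hρua⟩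
  have hexw : ∀ e, q.SameCycle a e → ∃ s ∈ t ⁻¹' {w}, q.SameCycle e s := fun e he =>
    ⟨ρw, hρw, he.symm.trans hρwa⟩
  have hmw : ∀ e, q.SameCycle a e → t (hit q (t ⁻¹' {w}) e) = w := fun e he => hit_mem (hexw e he)
  have haw : ∀ e, q.SameCycle a e → q.SameCycle a (hit q (t ⁻¹' {w}) e) := fun e he =>
    he.trans (sameCycle_hit (hexw e he))
  have hmx : t (hit q (t ⁻¹' {u}) x) = u := hit_mem (hexu x hax)
  have hhx := hax.trans (sameCycle_hit (hexu x hax))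
  -- Surgery at `u` cuts off the gap that contains `x`. Then the fibre of `x` meets both parts, and
  -- `w` meets the remaining part and the cycle of `c`, so non-crossing applies there.
  obtain ⟨α₀, hα₀, hne, hsame, hiff⟩ := exists_swap_sameCycle_iff_hit_eq (q := q)
    (S := t ⁻¹' {u}) hmx hρu (hhx.symm.trans hρua) hx.symm
  have haα := hhx.trans hsame
  obtain ⟨q', s, hq', hsp⟩ := hq.exists_isSplit hne (z := b') (Eq.trans hα₀ hb'.symm)
    (hmx.trans hb'.symm) hsame.symm (fun h => hab (haα.trans (h.trans hbb'.symm)))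
  have hfar : ∀ e, q.SameCycle a e → hit q (t ⁻¹' {u}) e ≠ hit q (t ⁻¹' {u}) x →
      q'.SameCycle e α₀ := fun e he h =>
    hsp.sameCycle_of_half ((sameCycle_mul_swap_or hne hsame.symm (he.symm.trans haα)).resolve_right
      fun h' => h ((hiff e (hhx.symm.trans he)).1 h'))
  have hnear : q'.SameCycle x (hit q (t ⁻¹' {u}) x) :=
    hsp.sameCycle_of_half ((hiff x (hhx.symm.trans hax)).2 rfl)
  have hc'iff : ∀ e, q'.SameCycle c' e ↔ q.SameCycle c' e := fun e =>
    hsp.sameCycle_iff (fun h => hac (haα.trans (h.symm.trans hcc'.symm)))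
      (fun h => hbc (hbb'.trans (h.symm.trans hcc'.symm)))
  have hc'a : ∀ e, q.SameCycle a e → ¬ q'.SameCycle c' e := fun e he h =>
    hac (he.trans (((hc'iff e).1 h).symm.trans hcc'.symm))
  by_contra hne'
  have hy1 := hfar _ (haw y hay) (by rw [hu _ (hmw y hay) (haw y hay)]; exact hx.symm)
  have hz1 := hfar _ (haw z haz) (by rw [hu _ (hmw z haz) (haw z haz)]; exact hx.symm)
  have hxα : ¬ q'.SameCycle x α₀ := fun h => hsp.not_sameCycle (h.symm.trans hnear)
  have h := hq'.sameCycle_mul_swap (z := c') (c := y) (d := z) (w := x) hne'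
    ((hmw y hay).trans hc'.symm) ((hmw z haz).trans hc'.symm) (hy1.trans hz1.symm)
    (fun h => hc'a _ (haw y hay) h.symm) (hyz.trans hxz.symm) hxz.symm
    ((hfar y hay hyx).trans hy1.symm) ((hfar z haz hzx).trans hy1.symm)
    (fun h => hxα (h.trans hy1)) (fun h => hc'a x hax h.symm)
  -- the transpositions at `u` and at `w` commute
  have hdisj : ∀ i j k l : α, t i = u → t j = u → t k = w → t l = w →
      swap i j * swap k l = swap k l * swap i j := by
    intro i j k l hi hj hk hl
    refine (Equiv.Perm.Disjoint.commute ?_).eq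
    rw [disjoint_iff_eq_or_eq]
    intro d
    by_cases hd : t d = u
    · right
      exact swap_apply_of_ne_of_ne (fun e => huw (hd.symm.trans (e ▸ hk)))
        (fun e => huw (hd.symm.trans (e ▸ hl)))
    · left
      exact swap_apply_of_ne_of_ne (fun e => hd (e ▸ hi)) (fun e => hd (e ▸ hj))
  have hs : t s = u := by
    rcases hsp.mem with rfl | rfl
    · exact hα₀
    · exact hmx
  rw [hsp.eq, mul_assoc _ (swap s b'), hdisj s b' _ _ hs hb' (hmw y hay) (hmw z haz),
    ← mul_assoc, mul_assoc q, hdisj _ _ _ _ hα₀ hmx (hmw y hay) (hmw z haz), ← mul_assoc] at h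
  have h0 := not_sameCycle_mul_swap_hit (hexw y hay) (hexw z haz) (hay.symm.trans haz) hne'
  have hq0 : ∀ {i j}, (q * swap (hit q (t ⁻¹' {w}) y) (hit q (t ⁻¹' {w}) z)).SameCycle i j →
      q.SameCycle i j := fun hij =>
    sameCycle_of_mul_swap hne' ((haw y hay).symm.trans (haw z haz)) hij
  have hg0 : ∀ i, t i = u → q.SameCycle a i →
      (q * swap (hit q (t ⁻¹' {w}) y) (hit q (t ⁻¹' {w}) z)).SameCycle i ρw := fun i hi hai => by
    rw [← hw i hi hai]
    refine sameCycle_hit_of_eqOn (fun d hd => ?_) (hexw i hai)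
    have h1 : d ≠ hit q (t ⁻¹' {w}) y := fun h => hd (h ▸ hmw y hay)
    have h2 : d ≠ hit q (t ⁻¹' {w}) z := fun h => hd (h ▸ hmw z haz)
    rw [mul_apply, swap_apply_of_ne_of_ne h1 h2]
  have hsame0 := (hg0 α₀ hα₀ haα).trans (hg0 _ hmx hhx).symm
  have hb1 : ∀ i, q.SameCycle a i →
      ¬ (q * swap (hit q (t ⁻¹' {w}) y) (hit q (t ⁻¹' {w}) z) *
        swap α₀ (hit q (t ⁻¹' {u}) x)).SameCycle i b' := fun i hi h =>
    hab (hi.trans ((hq0 (sameCycle_of_mul_swap hne hsame0 h)).trans hbb'.symm))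
  rw [sameCycle_mul_swap_iff (hb1 s (haα.trans hsp.sameCycle_left))] at h
  refine h0 (sameCycle_of_mul_swap hne hsame0 ?_)
  rcases h with h | ⟨h1, h2⟩
  · exact h
  · exact (h1.resolve_right (hb1 y hay)).trans (h2.resolve_right (hb1 z haz)).symm

/-- All elements over `w` on the cycle lie in the gap `ρu`. From another gap of `u`, the next
element over `w` comes after the one over `u` that closes the gap. -/
theorem hit_eq_of_hit_ne {u w : V} {a ρu ρw e : α}
    (hu : ∀ e, t e = w → q.SameCycle a e → hit q (t ⁻¹' {u}) e = ρu)
    (hw : ∀ e, t e = u → q.SameCycle a e → hit q (t ⁻¹' {w}) e = ρw)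
    (hρu : t ρu = u) (hρua : q.SameCycle a ρu) (hae : q.SameCycle a e)
    (he : hit q (t ⁻¹' {u}) e ≠ ρu) : hit q (t ⁻¹' {w}) e = ρw := by
  have hex : ∃ s ∈ t ⁻¹' {u}, q.SameCycle e s := ⟨ρu, hρu, hae.symm.trans hρua⟩
  rcases hit_hit_or (T := t ⁻¹' {w}) hex with ⟨h, -⟩ | ⟨f, h1, h2, h3⟩
  · rw [h]
    exact hw _ (hit_mem hex) (hae.trans (sameCycle_hit hex))
  · exact absurd (h3.symm.trans (hu f h1 (hae.trans h2))) he

/-- An element next to one over `u` lies in the gap `ρw` of `w`, so `u` sees `Q` only through the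
gap `r`. -/
theorem IsTracing.ncard_row_le (hq : IsTracing t P q)
    (hm : ∀ y, {v | v ≠ y ∧ ¬ Linked t P y v}.ncard ≤ m) {u w : V} {a r ρw : α} {Q : Set V}
    (huQ : u ∉ Q) (hwQ : w ∉ Q) (huw : u ≠ w)
    (hw : ∀ e, t e = u → q.SameCycle a e → hit q (t ⁻¹' {w}) e = ρw)
    (hQ : ∀ e, t e ∈ Q → q.SameCycle a e ∧
      (hit q (t ⁻¹' {u}) e = r ∨ hit q (t ⁻¹' {w}) e ≠ ρw)) : Q.ncard ≤ m + 2 := by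
  refine hq.ncard_gap_le (hm u) (ρ := r) huQ fun e he hl => ?_
  obtain ⟨hae, h⟩ := hQ e he
  refine h.resolve_right fun hne => hne ?_
  rcases hl with hl | hl
  · rw [← hit_apply q (fun h : e ∈ t ⁻¹' {w} => hwQ ((show t e = w from h) ▸ he))]
    exact hw _ hl (hae.trans (sameCycle_self_apply q e))
  · have h1 : q⁻¹ e ∉ t ⁻¹' {w} := fun h => huw (hl.symm.trans h)
    have h2 := hit_apply q h1
    have h3 : q (q⁻¹ e) = e := by simp
    have h4 := sameCycle_self_apply q (q⁻¹ e)
    rw [h3] at h2 h4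
    rw [h2]
    exact hw _ hl (hae.trans h4.symm)

/-- Minimal tracings of dense relations have at most two cycles. -/
theorem IsMinTracing.numCycles_le_two (hq : IsMinTracing t P q)
    (hm : ∀ y, {v | v ≠ y ∧ ¬ Linked t P y v}.ncard ≤ m) (hn : 5 * m + 7 ≤ Nat.card V) :
    numCycles q ≤ 2 := by
  by_contra! hk
  obtain ⟨a, hstar⟩ := hq.exists_forall_touches hm hn hk
  obtain ⟨b, hab, -⟩ := exists_three_of_three_le_numCycles hk a a
  obtain ⟨c, hac, hbc⟩ := exists_three_of_three_le_numCycles hk a b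
  have hcb : ¬ q.SameCycle c b := fun h => hbc h.symm
  have hub := touches_self t q b
  have hwc := touches_self t q c
  have hua := hstar (t b)
  have hwa := hstar (t c)
  set u := t b
  set w := t c
  have huw : u ≠ w := fun h => hq.not_touches hua hub hab hac hbc (h ▸ hwc)
  obtain ⟨ρu, hρu, hρua, hu⟩ := hq.exists_main_gap hm hn hk hua hub hwa hwc hab hac hbc
  obtain ⟨ρw, hρw, hρwa, hw⟩ := hq.exists_main_gap hm hn hk hwa hwc hua hub hac hab hcb
  have hu' : ∀ e, t e = w → q.SameCycle a e → hit q (t ⁻¹' {u}) e = ρu := fun e he hae =>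
    hu e c (by rw [he]; exact hwc) hac hbc hae
  have hw' : ∀ e, t e = u → q.SameCycle a e → hit q (t ⁻¹' {w}) e = ρw := fun e he hae =>
    hw e b (by rw [he]; exact hub) hab hcb hae
  have hgap : ∀ (u : V) (b ρu : α), Touches t q u a → Touches t q u b → ¬ q.SameCycle a b →
      {v | ¬ Touches t q v b ∧ ∀ e, t e = v → q.SameCycle a e →
        hit q (t ⁻¹' {u}) e = ρu}.ncard ≤ m + 2 := by
    intro u b ρu hua hub hab
    refine hq.1.ncard_gap_le (hm u) (ρ := ρu) (fun h => h.1 hub) ?_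
    rintro e ⟨h1, h2⟩ hl
    obtain ⟨f, hf, hef⟩ := exists_sameCycle_of_linked hl
    refine h2 e rfl ?_
    exact ((hq.sameCycle_or hua hub hab hf).resolve_right
      fun h => h1 ⟨e, rfl, h.trans hef.symm⟩).trans hef.symm
  have hQu := hgap u b ρu hua hub hab
  have hQw := hgap w c ρw hwa hwc hac
  set Qu := {v | ¬ Touches t q v b ∧ ∀ e, t e = v → q.SameCycle a e →
    hit q (t ⁻¹' {u}) e = ρu} with hQudef
  set Qw := {v | ¬ Touches t q v c ∧ ∀ e, t e = v → q.SameCycle a e →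
    hit q (t ⁻¹' {w}) e = ρw} with hQwdef
  have hsum := card_le_of_forall_or (V := V) (S := Qu) (T := Qw) (U := {v | v ∉ Qu ∧ v ∉ Qw})
    (fun v => by simp only [Set.mem_ofPred_eq]; tauto)
  -- A fibre with a further cycle different from that of `b` lies in the main gap of `u`; one that
  -- meets `b` lies in the main gap of `w`.
  have hpure : ∀ e, t e ∉ Qu → t e ∉ Qw → q.SameCycle a e := by
    intro e h1 h2
    by_contra hae
    have hee := touches_self t q e
    by_cases hbe : q.SameCycle b e
    · refine h2 ⟨hq.not_touches (hstar _) (hee.congr hbe.symm) hab hac hbc, fun f hf haf => ?_⟩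
      exact hw f b (by rw [hf]; exact hee.congr hbe.symm) hab hcb haf
    · refine h1 ⟨hq.not_touches (hstar _) hee hae hab fun h => hbe h.symm, fun f hf haf => ?_⟩
      exact hu f e (by rw [hf]; exact hee) hae hbe haf
  have huE : u ∉ {v | v ∉ Qu ∧ v ∉ Qw} := fun h => hab (hpure b h.1 h.2)
  have hwE : w ∉ {v | v ∉ Qu ∧ v ∉ Qw} := fun h => hac (hpure c h.1 h.2)
  -- A remaining fibre lives in one non-main gap `r` of `u` and one non-main gap `κ` of `w`; these
  -- are its row and column.
  have hrc : ∀ v, ∃ r κ, v ∉ Qu → v ∉ Qw → r ≠ ρu ∧ κ ≠ ρw ∧ ∀ e, t e = v →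
      (hit q (t ⁻¹' {u}) e = r ∧ hit q (t ⁻¹' {w}) e = ρw) ∨
      (hit q (t ⁻¹' {w}) e = κ ∧ hit q (t ⁻¹' {u}) e = ρu) := by
    intro v
    by_cases hv : v ∉ Qu ∧ v ∉ Qw
    swap
    · exact ⟨a, a, fun h1 h2 => absurd ⟨h1, h2⟩ hv⟩
    have hva : ∀ e, t e = v → q.SameCycle a e := fun e he =>
      hpure e (by rw [he]; exact hv.1) (by rw [he]; exact hv.2)
    have hvb : ¬ Touches t q v b := fun ⟨e, he, hbe⟩ => hab ((hva e he).trans hbe.symm)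
    have hvc : ¬ Touches t q v c := fun ⟨e, he, hce⟩ => hac ((hva e he).trans hce.symm)
    obtain ⟨x, hx, hxρ⟩ : ∃ x, t x = v ∧ hit q (t ⁻¹' {u}) x ≠ ρu := by
      by_contra! h; exact hv.1 ⟨hvb, fun e he _ => h e he⟩
    obtain ⟨y, hy, hyρ⟩ : ∃ y, t y = v ∧ hit q (t ⁻¹' {w}) y ≠ ρw := by
      by_contra! h; exact hv.2 ⟨hvc, fun e he _ => h e he⟩
    refine ⟨_, _, fun _ _ => ⟨hxρ, hyρ, fun e he => ?_⟩⟩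
    have hyu := hit_eq_of_hit_ne hw' hu' hρw hρwa (hva y hy) hyρ
    by_cases hex : hit q (t ⁻¹' {u}) e = hit q (t ⁻¹' {u}) x
    · exact Or.inl ⟨hex, hit_eq_of_hit_ne hu' hw' hρu hρua (hva e he) (hex ▸ hxρ)⟩
    · right
      have h := hq.hit_eq_hit_of_crossing hub hwc hab hac hbc huw hρu hρua hρw hρwa hu' hw'
        (x := x) (y := e) (z := y) (hx.trans hy.symm) (he.trans hy.symm) (hva x hx) (hva e he)
        (hva y hy) hxρ hex (by rw [hyu]; exact hxρ.symm)
      exact ⟨h, hit_eq_of_hit_ne hw' hu' hρw hρwa (hva e he) (by rw [h]; exact hyρ)⟩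
  choose row col hrc using hrc
  have hE : {v | v ∉ Qu ∧ v ∉ Qw}.ncard ≤ 3 * m + 2 := by
    refine ncard_grid_le (R := Linked t P) (row := row) (col := col) hm ?_ ?_ ?_
    · intro x hx y hy hxy
      have key : ∀ e, t e ∈ {v | v ∉ Qu ∧ v ∉ Qw} → t (q e) ∈ {v | v ∉ Qu ∧ v ∉ Qw} →
          row (t e) = row (t (q e)) ∨ col (t e) = col (t (q e)) := by
        intro e h1 h2
        obtain ⟨h3, h4, h5⟩ := hrc _ h1.1 h1.2
        obtain ⟨h6, h7, h8⟩ := hrc _ h2.1 h2.2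
        have hu1 := hit_apply q (fun h : e ∈ t ⁻¹' {u} => huE ((show t e = u from h) ▸ h1))
        have hw1 := hit_apply q (fun h : e ∈ t ⁻¹' {w} => hwE ((show t e = w from h) ▸ h1))
        rcases h5 e rfl with ⟨i1, i2⟩ | ⟨i1, i2⟩ <;> rcases h8 (q e) rfl with ⟨j1, j2⟩ | ⟨j1, j2⟩
        · left; rw [← i1, ← j1, hu1]
        · exact absurd (i1.symm.trans (hu1.symm.trans j2)) h3
        · exact absurd (i1.symm.trans (hw1.symm.trans j2)) h4
        · right; rw [← i1, ← j1, hw1]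
      obtain ⟨e, ⟨rfl, rfl⟩ | ⟨rfl, rfl⟩⟩ := hq.1.linked hxy
      · exact key e hx hy
      · exact (key e hy hx).imp Eq.symm Eq.symm
    · intro x hx
      refine hq.1.ncard_row_le hm (u := u) (w := w) (a := a) (r := row x) (ρw := ρw)
        (fun h => huE h.1) (fun h => hwE h.1) huw hw' ?_
      rintro e ⟨h1, h2⟩
      obtain ⟨h3, h4, h5⟩ := hrc _ h1.1 h1.2
      refine ⟨hpure e h1.1 h1.2, (h5 e rfl).imp (fun h => h.1.trans h2) fun h => ?_⟩
      rw [h.1]; exact h4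
    · intro x hx
      refine hq.1.ncard_row_le hm (u := w) (w := u) (a := a) (r := col x) (ρw := ρu)
        (fun h => hwE h.1) (fun h => huE h.1) huw.symm hu' ?_
      rintro e ⟨h1, h2⟩
      obtain ⟨h3, h4, h5⟩ := hrc _ h1.1 h1.2
      refine ⟨hpure e h1.1 h1.2, (h5 e rfl).symm.imp (fun h => h.1.trans h2) fun h => ?_⟩
      rw [h.1]; exact h3
  omega

/-- The fibres of a map are the cycles of some permutation. -/
theorem exists_sameCycle_iff_eq (t : α → V) : ∃ r : Perm α, ∀ a b, r.SameCycle a b ↔ t a = t b := by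
  classical
  have : Fintype α := Fintype.ofFinite α
  have hcyc : ∀ v, ∃ f : Perm {a // t a = v}, ∀ a b, f.SameCycle a b := fun v => by
    obtain ⟨f, hf, -⟩ := Finset.exists_cycleOn (Finset.univ : Finset {a // t a = v})
    exact ⟨f, fun a b => hf.2 (by simp) (by simp)⟩
  choose f hf using hcyc
  let r : Perm α := (Equiv.sigmaFiberEquiv t).permCongr (Equiv.Perm.sigmaCongrRight f)
  have hr : ∀ v (a : {a // t a = v}), r a = (f v a : α) := by
    rintro _ ⟨a, rfl⟩
    simp [r, Equiv.sigmaFiberEquiv]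
  have hpow : ∀ (i : ℕ) v (a : {a // t a = v}), (r ^ i) a = ((f v ^ i) a : α) := by
    intro i
    induction i with
    | zero => intro v a; rfl
    | succ i ih => intro v a; rw [pow_succ, mul_apply, hr, ih, pow_succ, mul_apply]
  refine ⟨r, fun a b => ⟨fun h => ?_, fun h => ?_⟩⟩
  · refine h.rel_of_step (R := fun a b => t a = t b) ⟨fun _ => rfl, Eq.symm, Eq.trans⟩ fun a => ?_
    rw [hr (t a) ⟨a, rfl⟩]
    exact (f (t a) ⟨a, rfl⟩).2.symm
  · obtain ⟨i, hi⟩ := (hf (t b) ⟨a, h⟩ ⟨b, rfl⟩).exists_nat_pow_eq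
    refine ⟨i, ?_⟩
    rw [zpow_natCast, hpow i (t b) ⟨a, h⟩, hi]

/-- If every vertex is linked to all but few of the vertices, then there is a tracing with at most
two cycles. -/
theorem exists_isTracing_numCycles_le_two (t : α → V) (P : Perm α)
    (hm : ∀ y, {v | v ≠ y ∧ ¬ Linked t P y v}.ncard ≤ m) (hn : 5 * m + 7 ≤ Nat.card V) :
    ∃ q, IsTracing t P q ∧ numCycles q ≤ 2 := by
  classical
  obtain ⟨r, hr⟩ := exists_sameCycle_iff_eq t
  have hex : ∃ n q, IsTracing t P q ∧ numCycles q = n :=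
    ⟨_, P * r, fun a b => by rw [inv_mul_cancel_left, hr], rfl⟩
  obtain ⟨q, hq, hqn⟩ := Nat.find_spec hex
  refine ⟨q, hq, IsMinTracing.numCycles_le_two ⟨hq, fun q' hq' => ?_⟩ hm hn⟩
  rw [hqn]
  exact Nat.find_min' hex ⟨q', hq', rfl⟩

end StarContradiction

end Equiv.Perm

/-! ### Orbits of permutations as elements of `Cycle`. -/

section PeriodicOrbit

open Function

variable {α β : Type*}

theorem Equiv.Perm.mem_periodicPts [Finite α] (f : Equiv.Perm α) (x : α) :
    x ∈ periodicPts f :=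
  mk_mem_periodicPts (orderOf_pos f) (by
    rw [IsPeriodicPt, IsFixedPt, Equiv.Perm.iterate_eq_pow, pow_orderOf_eq_one]; rfl)

theorem Equiv.Perm.mem_periodicOrbit_iff_sameCycle [Finite α] (f : Equiv.Perm α) {x y : α} :
    y ∈ periodicOrbit f x ↔ f.SameCycle x y := by
  rw [mem_periodicOrbit_iff (f.mem_periodicPts x)]
  constructor
  · rintro ⟨n, rfl⟩
    exact ⟨n, by rw [zpow_natCast, Equiv.Perm.iterate_eq_pow]⟩
  · intro h
    obtain ⟨n, hn⟩ := h.exists_nat_pow_eq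
    exact ⟨n, by rwa [Equiv.Perm.iterate_eq_pow]⟩

theorem Equiv.Perm.periodicOrbit_eq_iff_sameCycle [Finite α] (f : Equiv.Perm α) {x y : α} :
    periodicOrbit f x = periodicOrbit f y ↔ f.SameCycle x y := by
  constructor
  · intro h
    rw [← f.mem_periodicOrbit_iff_sameCycle, h]
    exact self_mem_periodicOrbit (f.mem_periodicPts y)
  · intro h
    obtain ⟨n, rfl⟩ := h.exists_nat_pow_eq
    rw [← Equiv.Perm.iterate_eq_pow, periodicOrbit_apply_iterate_eq (f.mem_periodicPts x)]

theorem Equiv.Perm.ncard_range_periodicOrbit [Finite α] (f : Equiv.Perm α) :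
    (Set.range (periodicOrbit f)).ncard = f.numCycles := by
  let g : Quotient (SameCycle.setoid f) → Cycle α :=
    Quotient.lift (periodicOrbit f) fun _ _ h => f.periodicOrbit_eq_iff_sameCycle.2 h
  have hg : Function.Injective g := by
    intro c d
    induction c using Quotient.inductionOn
    induction d using Quotient.inductionOn
    exact fun h => Quotient.sound (f.periodicOrbit_eq_iff_sameCycle.1 h)
  have hr : Set.range (periodicOrbit f) = Set.range g := by
    ext c
    constructor
    · rintro ⟨x, rfl⟩
      exact ⟨⟦x⟧, rfl⟩
    · rintro ⟨d, rfl⟩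
      induction d using Quotient.inductionOn with | _ x
      exact ⟨x, rfl⟩
  rw [hr, Set.ncard_range_of_injective hg, Equiv.Perm.numCycles]

theorem Function.Semiconj.periodicOrbit_eq_map {f : α → α} {g : β → β} {φ : α → β}
    (hφ : Injective φ) (h : Semiconj φ f g) (x : α) :
    periodicOrbit g (φ x) = (periodicOrbit f x).map φ := by
  have hit : ∀ n, g^[n] (φ x) = φ (f^[n] x) := fun n => ((h.iterate_right n).eq x).symm
  have hp : minimalPeriod g (φ x) = minimalPeriod f x := by
    rw [minimalPeriod_eq_minimalPeriod_iff]
    intro n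
    rw [IsPeriodicPt, IsFixedPt, hit, hφ.eq_iff]
    rfl
  rw [periodicOrbit_def, periodicOrbit_def, hp, Cycle.map_coe, List.map_map]
  congr 1
  exact List.map_congr_left fun n _ => hit n

theorem Equiv.Perm.numCycles_eq_card_of_surjective {V : Type*} {f : Equiv.Perm α} {t : α → V}
    (ht : Function.Surjective t) (h : ∀ a b, f.SameCycle a b ↔ t a = t b) :
    f.numCycles = Nat.card V := by
  refine Nat.card_eq_of_bijective (fun c : Quotient (SameCycle.setoid f) =>
    Quotient.lift t (fun a b hab => (h a b).1 hab) c) ⟨?_, ?_⟩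
  · intro c d
    induction c using Quotient.inductionOn
    induction d using Quotient.inductionOn
    exact fun hcd => Quotient.sound ((h _ _).2 hcd)
  · intro v
    obtain ⟨a, rfl⟩ := ht v
    exact ⟨⟦a⟧, rfl⟩

namespace Cycle

theorem chain_coe_iff_getElem (r : α → α → Prop) (l : List α) :
    Chain r (l : Cycle α) ↔
      ∀ i (hi : i < l.length), r l[i] (l[(i + 1) % l.length]'(Nat.mod_lt _ (by omega))) := by
  cases l with
  | nil => simp
  | cons a l =>
    rw [chain_coe_cons, List.isChain_iff_getElem]
    constructor
    · intro h i hi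
      have := h i (by simpa using hi)
      rw [List.length_cons] at hi
      rcases (Nat.lt_succ_iff.1 hi).eq_or_lt with rfl | hlt
      · simp only [List.length_cons, Nat.mod_self, List.getElem_cons_zero]
        convert this using 1
        · rw [List.getElem_cons, List.getElem_cons]
          split
          · rfl
          · rw [List.getElem_append_left]
        · simp
      · simp only [List.length_cons, Nat.mod_eq_of_lt (Nat.succ_lt_succ hlt)]
        convert this using 1
        · rw [List.getElem_cons, List.getElem_cons]
          split
          · rfl
          · rw [List.getElem_append_left]
        · simp [List.getElem_append_left hlt]
    · intro h i hi
      simp only [List.length_cons, List.length_append, List.length_nil] at hi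
      have hi' : i < (a :: l).length := by simp; omega
      have := h i hi'
      rcases (show i ≤ l.length by omega).eq_or_lt with rfl | hlt
      · simp only [List.length_cons, Nat.mod_self, List.getElem_cons_zero] at this
        convert this using 1
        · rw [List.getElem_cons, List.getElem_cons]
          split
          · rfl
          · rw [List.getElem_append_left]
        · simp
      · simp only [List.length_cons, Nat.mod_eq_of_lt (Nat.succ_lt_succ hlt)] at this
        convert this using 1
        · rw [List.getElem_cons, List.getElem_cons]
          split
          · rfl
          · rw [List.getElem_append_left]
        · simp [List.getElem_append_left hlt]

theorem Chain.next [DecidableEq α] {r : α → α → Prop} {c : Cycle α} (hc : c.Nodup)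
    (h : c.Chain r) {x : α} (hx : x ∈ c) : r x (c.next hc x hx) := by
  induction c using Quotient.inductionOn' with | _ l
  have hx' : x ∈ l := hx
  have hl : l.Nodup := hc
  obtain ⟨i, hi, rfl⟩ := List.getElem_of_mem hx'
  have := (chain_coe_iff_getElem r l).1 h i hi
  rw [← List.next_getElem l hl i hi] at this
  exact this

/-- A cycle without repetitions is the orbit of any function that moves along it. -/
theorem periodicOrbit_eq [DecidableEq α] {c : Cycle α} (hc : c.Nodup) {f : α → α}
    (hf : ∀ x (hx : x ∈ c), f x = c.next hc x hx) {a : α} (ha : a ∈ c) : periodicOrbit f a = c := by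
  induction c using Quotient.inductionOn' with | _ l₀
  have ha' : a ∈ l₀ := ha
  obtain ⟨k, hk, rfl⟩ := List.getElem_of_mem ha'
  have hf' : ∀ i (hi : i < l₀.length),
      f l₀[i] = l₀[(i + 1) % l₀.length]'(Nat.mod_lt _ (by omega)) := by
    intro i hi
    rw [← List.next_getElem l₀ hc i hi]
    exact hf _ (List.getElem_mem hi)
  have hpos : 0 < l₀.length := by omega
  have hit : ∀ n, f^[n] l₀[k] = l₀[(k + n) % l₀.length]'(Nat.mod_lt _ hpos) := by
    intro n
    induction n with
    | zero => simp [Nat.mod_eq_of_lt hk]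
    | succ n ih =>
      rw [iterate_succ_apply', ih, hf']
      congr 1
      rw [Nat.mod_add_mod, add_assoc]
  have hnd : l₀.Nodup := hc
  have hper : minimalPeriod f l₀[k] = l₀.length := by
    apply Nat.dvd_antisymm
    · refine IsPeriodicPt.minimalPeriod_dvd ?_
      rw [IsPeriodicPt, IsFixedPt, hit]
      congr 1
      rw [Nat.add_mod_right, Nat.mod_eq_of_lt hk]
    · have h1 := isPeriodicPt_minimalPeriod f l₀[k]
      rw [IsPeriodicPt, IsFixedPt, hit, hnd.getElem_inj_iff] at h1
      have h2 : (k + minimalPeriod f l₀[k]) ≡ k + 0 [MOD l₀.length] := by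
        rw [Nat.ModEq, h1, add_zero, Nat.mod_eq_of_lt hk]
      exact (Nat.modEq_zero_iff_dvd).1 (Nat.ModEq.add_left_cancel' k h2)
  rw [periodicOrbit_def, hper]
  refine Cycle.coe_eq_coe.2 (List.IsRotated.symm ⟨k, List.ext_getElem (by simp) fun n h1 h2 => ?_⟩)
  rw [List.getElem_rotate, List.getElem_map, List.getElem_range, hit]
  congr 1
  rw [add_comm]

theorem map_injective_of_leftInverse {f : α → β} {g : β → α} (h : LeftInverse g f) :
    Injective (Cycle.map f) := by
  have : LeftInverse (Cycle.map g) (Cycle.map f) := by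
    intro c
    induction c using Quotient.inductionOn' with | _ l
    show Cycle.map g (Cycle.map f (l : Cycle α)) = l
    rw [map_coe, map_coe, List.map_map, h.comp_eq_id, List.map_id]
  exact this.injective

theorem map_map_of_leftInverse {f : α → β} {g : β → α} (h : LeftInverse g f) (c : Cycle α) :
    (c.map f).map g = c := by
  induction c using Quotient.inductionOn' with | _ l
  show Cycle.map g (Cycle.map f (l : Cycle α)) = l
  rw [map_coe, map_coe, List.map_map, h.comp_eq_id, List.map_id]

end Cycle

end PeriodicOrbit

/-! ### From tracings to directed embeddings. -/

namespace MultiDigraph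

open Equiv.Perm Function

variable {V A : Type*} {D : MultiDigraph V A}

/-- The permutation that sends every arc to its successor in its circuit. -/
theorem IsCircuitDecomposition.exists_perm {𝒞 : Finset (Cycle A)}
    (h : D.IsCircuitDecomposition 𝒞) :
    ∃ P : Equiv.Perm A, (∀ a, D.src (P a) = D.tgt a) ∧
      ∀ C ∈ 𝒞, ∀ a ∈ C, periodicOrbit P a = C := by
  classical
  obtain ⟨hC, huniq⟩ := h
  choose c hc hcu using huniq
  have hnd : ∀ a, (c a).Nodup := fun a => (hC _ (hc a).1).2.1
  have hnext : ∀ a, c ((c a).next (hnd a) a (hc a).2) = c a := fun a =>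
    (hcu _ _ ⟨(hc a).1, Cycle.next_mem _ _ _ _⟩).symm
  have hprev : ∀ a, c ((c a).prev (hnd a) a (hc a).2) = c a := fun a =>
    (hcu _ _ ⟨(hc a).1, Cycle.prev_mem _ _ _ _⟩).symm
  -- The circuits are variables so that their equality can be substituted in the proof arguments of
  -- `next` and `prev`.
  have key1 : ∀ (C C' : Cycle A) (h1 : C.Nodup) (h2 : C'.Nodup) (a : A) (ha : a ∈ C)
      (h3 : C.next h1 a ha ∈ C'), C' = C → C'.prev h2 (C.next h1 a ha) h3 = a := by
    rintro C C' h1 h2 a ha h3 rfl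
    exact Cycle.prev_next _ _ _ _
  have key2 : ∀ (C C' : Cycle A) (h1 : C.Nodup) (h2 : C'.Nodup) (a : A) (ha : a ∈ C)
      (h3 : C.prev h1 a ha ∈ C'), C' = C → C'.next h2 (C.prev h1 a ha) h3 = a := by
    rintro C C' h1 h2 a ha h3 rfl
    exact Cycle.next_prev _ _ _ _
  let P : Equiv.Perm A :=
    { toFun := fun a => (c a).next (hnd a) a (hc a).2
      invFun := fun a => (c a).prev (hnd a) a (hc a).2
      left_inv := fun a => key1 _ _ _ _ _ _ _ (hnext a)
      right_inv := fun a => key2 _ _ _ _ _ _ _ (hprev a) }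
  refine ⟨P, fun a => ?_, fun C hC' a ha => ?_⟩
  · exact ((hC _ (hc a).1).2.2.next (hnd a) (hc a).2).symm
  · refine Cycle.periodicOrbit_eq (hC C hC').2.1 (fun x hx => ?_) ha
    have hCx : C = c x := hcu x C ⟨hC', hx⟩
    subst hCx
    rfl

/-- The embedding with the given successor permutations of the arcs along the profaces and the
antifaces. -/
def embeddingOfPerms [Finite A] (P q : Equiv.Perm A) (hP : ∀ a, D.src (P a) = D.tgt a)
    (hq : IsTracing D.tgt P q) : D.OrientedEmbedding where
  rot :=
    -- Incoming and outgoing arcs alternate. Face tracing then acts as `P` on outgoing and as `q⁻¹`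
    -- on incoming half-arcs.
    { toFun := Sum.elim (fun b => Sum.inr (P⁻¹ b)) (fun a => Sum.inl (q a))
      invFun := Sum.elim (fun b => Sum.inr (q⁻¹ b)) (fun a => Sum.inl (P a))
      left_inv := by rintro (a | a) <;> simp
      right_inv := by rintro (a | a) <;> simp }
  sameCycle_iff := by
    set rot : Equiv.Perm (A ⊕ A) :=
      { toFun := Sum.elim (fun b => Sum.inr (P⁻¹ b)) (fun a => Sum.inl (q a))
        invFun := Sum.elim (fun b => Sum.inr (q⁻¹ b)) (fun a => Sum.inl (P a))
        left_inv := by rintro (a | a) <;> simp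
        right_inv := by rintro (a | a) <;> simp } with hrot
    have hl : ∀ b, rot (Sum.inl b) = Sum.inr (P⁻¹ b) := fun b => rfl
    have hr : ∀ a, rot (Sum.inr a) = Sum.inl (q a) := fun b => rfl
    have hPinv : ∀ b, D.tgt (P⁻¹ b) = D.src b := fun b => by rw [← hP]; simp
    intro h h'
    constructor
    · refine fun hh => hh.rel_of_step (R := fun h h' => D.halfArcVertex h = D.halfArcVertex h')
        ⟨fun _ => rfl, Eq.symm, Eq.trans⟩ ?_
      rintro (b | a)
      · rw [hl]
        exact (hPinv b).symm
      · rw [hr]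
        show D.tgt a = D.src (q a)
        rw [← hPinv, ← mul_apply]
        exact (hq _ _).1 (sameCycle_self_apply _ a)
    · have key : ∀ a a', D.tgt a = D.tgt a' → rot.SameCycle (Sum.inr a) (Sum.inr a') := by
        intro a a' haa
        refine ((hq a a').2 haa).rel_of_step
          (R := fun a a' => rot.SameCycle (Sum.inr a) (Sum.inr a'))
          ⟨fun _ => SameCycle.refl _ _, SameCycle.symm, SameCycle.trans⟩ fun a => ?_
        have h1 := sameCycle_self_apply rot (Sum.inr a)
        have h2 := sameCycle_self_apply rot (rot (Sum.inr a))
        exact h1.trans h2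
      have hin : ∀ h, ∃ a, rot.SameCycle h (Sum.inr a) ∧ D.tgt a = D.halfArcVertex h := by
        rintro (b | a)
        · exact ⟨P⁻¹ b, sameCycle_self_apply rot (Sum.inl b), hPinv b⟩
        · exact ⟨a, SameCycle.refl _ _, rfl⟩
      intro hh
      obtain ⟨a, h1, h2⟩ := hin h
      obtain ⟨a', h3, h4⟩ := hin h'
      exact h1.trans ((key a a' (h2.trans (hh.trans h4.symm))).trans h3.symm)

section OfPerms

variable [Finite A] {P q : Equiv.Perm A} (hP : ∀ a, D.src (P a) = D.tgt a)
  (hq : IsTracing D.tgt P q)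

theorem periodicOrbit_inl (a : A) :
    periodicOrbit (embeddingOfPerms P q hP hq).faceStep (Sum.inl a) =
      (periodicOrbit P a).map Sum.inl :=
  Semiconj.periodicOrbit_eq_map Sum.inl_injective (fun _ => rfl) a

theorem periodicOrbit_inr (a : A) :
    periodicOrbit (embeddingOfPerms P q hP hq).faceStep (Sum.inr a) =
      (periodicOrbit (q⁻¹ : Equiv.Perm A) a).map Sum.inr :=
  Semiconj.periodicOrbit_eq_map Sum.inr_injective (fun _ => rfl) a

theorem profaces_embeddingOfPerms : (embeddingOfPerms P q hP hq).profaces =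
    Cycle.map Sum.inl '' Set.range (periodicOrbit P) := by
  ext W
  constructor
  · rintro ⟨⟨a | a, rfl⟩, h⟩
    · exact ⟨_, ⟨a, rfl⟩, (periodicOrbit_inl hP hq a).symm⟩
    · exact absurd (h _ (self_mem_periodicOrbit (mem_periodicPts _ _))) (by simp)
  · rintro ⟨_, ⟨a, rfl⟩, rfl⟩
    refine ⟨⟨Sum.inl a, periodicOrbit_inl hP hq a⟩, fun h hh => ?_⟩
    obtain ⟨b, -, rfl⟩ := Cycle.mem_map.1 hh
    rfl

theorem antifaces_embeddingOfPerms : (embeddingOfPerms P q hP hq).antifaces =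
    Cycle.map Sum.inr '' Set.range (periodicOrbit (q⁻¹ : Equiv.Perm A)) := by
  ext W
  constructor
  · rintro ⟨⟨a | a, rfl⟩, h⟩
    · exact absurd (h _ (self_mem_periodicOrbit (mem_periodicPts _ _))) (by simp)
    · exact ⟨_, ⟨a, rfl⟩, (periodicOrbit_inr hP hq a).symm⟩
  · rintro ⟨_, ⟨a, rfl⟩, rfl⟩
    refine ⟨⟨Sum.inr a, periodicOrbit_inr hP hq a⟩, fun h hh => ?_⟩
    obtain ⟨b, -, rfl⟩ := Cycle.mem_map.1 hh
    rfl

theorem faces_embeddingOfPerms : (embeddingOfPerms P q hP hq).faces =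
    (embeddingOfPerms P q hP hq).profaces ∪ (embeddingOfPerms P q hP hq).antifaces := by
  rw [profaces_embeddingOfPerms, antifaces_embeddingOfPerms]
  ext W
  constructor
  · rintro ⟨a | a, rfl⟩
    · exact Or.inl ⟨_, ⟨a, rfl⟩, (periodicOrbit_inl hP hq a).symm⟩
    · exact Or.inr ⟨_, ⟨a, rfl⟩, (periodicOrbit_inr hP hq a).symm⟩
  · rintro (⟨_, ⟨a, rfl⟩, rfl⟩ | ⟨_, ⟨a, rfl⟩, rfl⟩)
    · exact ⟨Sum.inl a, periodicOrbit_inl hP hq a⟩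
    · exact ⟨Sum.inr a, periodicOrbit_inr hP hq a⟩

theorem isDirected_embeddingOfPerms : (embeddingOfPerms P q hP hq).IsDirected := by
  intro W hW
  rwa [faces_embeddingOfPerms] at hW

theorem profaceWalks_embeddingOfPerms :
    (embeddingOfPerms P q hP hq).profaceWalks = Set.range (periodicOrbit P) := by
  ext C
  rw [OrientedEmbedding.profaceWalks, profaces_embeddingOfPerms]
  constructor
  · rintro ⟨_, ⟨C, hC, rfl⟩, rfl⟩
    rwa [Cycle.map_map_of_leftInverse (f := Sum.inl) (g := arcOf) fun _ => rfl]
  · intro hC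
    exact ⟨_, ⟨C, hC, rfl⟩,
      (Cycle.map_map_of_leftInverse (f := Sum.inl) (g := arcOf) (fun _ => rfl) C).symm⟩

theorem ncard_antifaces_embeddingOfPerms :
    (embeddingOfPerms P q hP hq).antifaces.ncard = q.numCycles := by
  rw [antifaces_embeddingOfPerms, Set.ncard_image_of_injective _
    (Cycle.map_injective_of_leftInverse (f := Sum.inr) (g := arcOf) fun _ => rfl),
    ncard_range_periodicOrbit, numCycles_inv]

theorem ncard_faces_embeddingOfPerms :
    (embeddingOfPerms P q hP hq).faces.ncard = P.numCycles + q.numCycles := by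
  have hdisj : Disjoint (embeddingOfPerms P q hP hq).profaces
      (embeddingOfPerms P q hP hq).antifaces := by
    refine Set.disjoint_left.2 ?_
    rintro _ ⟨⟨a, rfl⟩, h1⟩ ⟨-, h2⟩
    have ha := self_mem_periodicOrbit
      (mem_periodicPts (embeddingOfPerms P q hP hq).faceStep a)
    have := h1 _ ha
    have := h2 _ ha
    cases a <;> simp_all
  have hfin1 : (embeddingOfPerms P q hP hq).profaces.Finite := by
    rw [profaces_embeddingOfPerms]; exact (Set.finite_range _).image _
  have hfin2 : (embeddingOfPerms P q hP hq).antifaces.Finite := by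
    rw [antifaces_embeddingOfPerms]; exact (Set.finite_range _).image _
  rw [faces_embeddingOfPerms, Set.ncard_union_eq hdisj hfin1 hfin2,
    ncard_antifaces_embeddingOfPerms, profaces_embeddingOfPerms, Set.ncard_image_of_injective _
      (Cycle.map_injective_of_leftInverse (f := Sum.inl) (g := arcOf) fun _ => rfl),
    ncard_range_periodicOrbit]

end OfPerms

namespace OrientedEmbedding

/-- `faceStep` is the product of `rot⁻¹`, with `|V|` cycles, and an involution with `|A|` cycles;
comparing signs gives the parity in Euler's formula. -/
theorem even_faces [Fintype V] [Fintype A] (Ψ : D.OrientedEmbedding)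
    (hD : Surjective D.tgt) :
    Even (Ψ.faces.ncard + Fintype.card V + Fintype.card A) := by
  classical
  have hrot : Ψ.rot.numCycles = Fintype.card V := by
    rw [← Nat.card_eq_fintype_card]
    refine numCycles_eq_card_of_surjective (fun v => ?_) Ψ.sameCycle_iff
    obtain ⟨a, rfl⟩ := hD v
    exact ⟨Sum.inr a, rfl⟩
  have hcomm : numCycles (Equiv.sumComm A A : Equiv.Perm (A ⊕ A)) = Fintype.card A := by
    rw [← Nat.card_eq_fintype_card]
    refine numCycles_eq_card_of_surjective (t := (arcOf : A ⊕ A → A)) (fun a => ⟨Sum.inl a, rfl⟩)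
      fun h h' => ⟨fun hh => ?_, fun hh => ?_⟩
    · refine hh.rel_of_step (R := fun h h' => (arcOf h : A) = arcOf h')
        ⟨fun _ => rfl, Eq.symm, Eq.trans⟩ ?_
      rintro (a | a) <;> rfl
    · rcases h with a | a <;> rcases h' with b | b <;> obtain rfl : a = b := hh
      · exact SameCycle.refl _ _
      · exact sameCycle_self_apply (Equiv.sumComm A A : Equiv.Perm (A ⊕ A)) (Sum.inl a)
      · exact sameCycle_self_apply (Equiv.sumComm A A : Equiv.Perm (A ⊕ A)) (Sum.inr a)
      · exact SameCycle.refl _ _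
  have hfaces : Ψ.faces.ncard = numCycles Ψ.faceStep := ncard_range_periodicOrbit Ψ.faceStep
  have hstep : Ψ.faceStep = Ψ.rot⁻¹ * (Equiv.sumComm A A : Equiv.Perm (A ⊕ A)) := rfl
  have hsign := sign_eq_neg_one_pow_numCycles Ψ.faceStep
  rw [← hfaces, hstep, Equiv.Perm.sign_mul, Equiv.Perm.sign_inv, sign_eq_neg_one_pow_numCycles,
    sign_eq_neg_one_pow_numCycles, hrot, hcomm, Fintype.card_sum, ← pow_add] at hsign
  by_contra hodd
  rw [Nat.not_even_iff_odd] at hodd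
  have h1 : ((-1 : ℤˣ)) ^ (Ψ.faces.ncard + Fintype.card V + Fintype.card A) = -1 :=
    hodd.neg_one_pow
  have h2 : ∀ n : ℕ, ((-1 : ℤˣ)) ^ (n + n) = 1 := fun n => (Even.add_self n).neg_one_pow
  simp only [pow_add, h2, one_mul] at hsign h1
  rw [← hsign] at h1
  have h3 : ((-1 : ℤˣ)) ^ (Fintype.card V + Fintype.card A) *
      (-1) ^ (Fintype.card V + Fintype.card A) = 1 := by
    rw [← pow_add, h2]
  rw [pow_add] at h3
  rw [mul_assoc, h3] at h1
  exact absurd h1 (by decide)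

/-- A directed embedding in which all circuits of a decomposition bound faces has another face. -/
theorem card_lt_ncard_faces [Finite A] (Ψ : D.OrientedEmbedding) (hΨ : Ψ.IsDirected)
    {𝒞 : Finset (Cycle A)} (h𝒞 : D.IsCircuitDecomposition 𝒞) (a : A)
    (h : ∀ C ∈ 𝒞, C ∈ Ψ.profaceWalks ∨ C ∈ Ψ.antifaceWalks) :
    𝒞.card < Ψ.faces.ncard := by
  classical
  have hW : ∀ C, ∃ W, C ∈ 𝒞 → W ∈ Ψ.faces ∧ ∀ b, b ∈ C ↔ ∃ h ∈ W, arcOf h = b := by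
    intro C
    by_cases hC : C ∈ 𝒞
    · rcases h C hC with ⟨W, hW, rfl⟩ | ⟨W, hW, rfl⟩
      · exact ⟨W, fun _ => ⟨hW.1, fun b => Cycle.mem_map⟩⟩
      · exact ⟨W, fun _ => ⟨hW.1, fun b => by rw [Cycle.mem_reverse_iff, Cycle.mem_map]⟩⟩
    · exact ⟨Cycle.nil, fun h => absurd h hC⟩
  choose W hW using hW
  have huniq : ∀ C ∈ 𝒞, ∀ C' ∈ 𝒞, ∀ b, b ∈ C → b ∈ C' → C = C' := fun C hC C' hC' b h1 h2 =>
    (h𝒞.2 b).unique ⟨hC, h1⟩ ⟨hC', h2⟩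
  have hne : ∀ C ∈ 𝒞, ∃ b, b ∈ C := by
    intro C hC
    obtain ⟨h1, -⟩ := h𝒞.1 C hC
    induction C using Cycle.induction_on with
    | nil => exact absurd rfl h1
    | cons b l _ => exact ⟨b, by simp⟩
  have hinj : Set.InjOn W (𝒞 : Set (Cycle A)) := by
    intro C hC C' hC' hCC
    obtain ⟨b, hb⟩ := hne C hC
    refine huniq C hC C' hC' b hb ?_
    rw [(hW C' hC').2, ← hCC, ← (hW C hC).2]
    exact hb
  obtain ⟨C₀, ⟨hC₀, ha⟩, -⟩ := h𝒞.2 a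
  obtain ⟨k, hk, hka⟩ := ((hW C₀ hC₀).2 a).1 ha
  have hfin : Ψ.faces.Finite := Set.finite_range _
  rw [← Set.ncard_coe_finset, ← hinj.ncard_image]
  refine Set.ncard_lt_ncard (Set.ssubset_iff_exists.2 ⟨?_, ?_⟩) hfin
  · rintro _ ⟨C, hC, rfl⟩
    exact (hW C hC).1
  -- The face at the other half of `a` is new: otherwise it would be the face of `C₀` and use `a` in
  -- both directions.
  · set k' := Equiv.sumComm A A k with hk'
    have hk'a : arcOf k' = a := by
      rw [← hka]; rcases k with k | k <;> rfl
    have hmem : k' ∈ periodicOrbit Ψ.faceStep k' :=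
      self_mem_periodicOrbit (mem_periodicPts Ψ.faceStep k')
    refine ⟨_, ⟨k', rfl⟩, ?_⟩
    rintro ⟨C, hC, hCW⟩
    have haC : a ∈ C := by
      rw [(hW C hC).2, hCW]
      exact ⟨k', hmem, hk'a⟩
    obtain rfl := huniq C hC C₀ hC₀ a haC ha
    rw [← hCW] at hmem
    rcases hΨ _ (hW C hC).1 with h | h
    · have h1 := h.2 _ hk
      have h2 := h.2 _ hmem
      rcases k with k | k <;> simp_all
    · have h1 := h.2 _ hk
      have h2 := h.2 _ hmem
      rcases k with k | k <;> simp_all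

end OrientedEmbedding

/-- The predecessor `P⁻¹ a` of an arc `a` ends where `a` starts. -/
theorem linked_of_adj {P : Equiv.Perm A} (hP : ∀ a, D.src (P a) = D.tgt a) {u v : V}
    (h : D.underlying.Adj u v) : Linked D.tgt P u v := by
  have key : ∀ a, Linked D.tgt P (D.src a) (D.tgt a) := fun a =>
    ⟨P⁻¹ a, Or.inl ⟨by rw [← hP]; simp, by simp⟩⟩
  rw [underlying, SimpleGraph.fromRel_adj] at h
  obtain ⟨-, ⟨a, rfl, rfl⟩ | ⟨a, rfl, rfl⟩⟩ := h
  · exact key a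
  · exact (key a).symm

end MultiDigraph

/-! ### The theorem. -/

open MultiDigraph Equiv.Perm in
theorem theorem4p1 {V A : Type*} [Fintype V] [Fintype A] (D : MultiDigraph V A)
    [DecidableRel D.underlying.Adj] (hD : D.IsEulerian)
    (hdeg : (4 * (Fintype.card V : ℚ) + 2) / 5 ≤ (D.underlying.minDegree : ℚ))
    (𝒞 : Finset (Cycle A)) (h𝒞 : D.IsCircuitDecomposition 𝒞) :
    ∃ Φ : D.OrientedEmbedding,
      Φ.IsDirected ∧
      Φ.profaceWalks = (𝒞 : Set (Cycle A)) ∧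
      (Odd (Fintype.card V + Fintype.card A + 𝒞.card) → Φ.antifaces.ncard = 1) ∧
      (Even (Fintype.card V + Fintype.card A + 𝒞.card) → Φ.antifaces.ncard = 2) ∧
      ∀ Ψ : D.OrientedEmbedding, Ψ.IsDirected →
        (∀ C ∈ 𝒞, C ∈ Ψ.profaceWalks ∨ C ∈ Ψ.antifaceWalks) →
        Ψ.genus ≤ Φ.genus := by
  classical
  obtain ⟨P, hP, hPC⟩ := h𝒞.exists_perm
  have hdeg' : 4 * Fintype.card V + 2 ≤ 5 * D.underlying.minDegree := by
    have : 4 * (Fintype.card V : ℚ) + 2 ≤ 5 * (D.underlying.minDegree : ℚ) := by linarith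
    exact_mod_cast this
  have : Nonempty V := hD.1.nonempty
  have hlt := D.underlying.minDegree_lt_card
  have hm : ∀ y, {v | v ≠ y ∧ ¬ Linked D.tgt P y v}.ncard ≤
      Fintype.card V - 1 - D.underlying.minDegree := by
    intro y
    have hsub : {v | v ≠ y ∧ ¬ Linked D.tgt P y v} ⊆
        ((insert y (D.underlying.neighborFinset y))ᶜ : Finset V) := by
      rintro v ⟨h1, h2⟩
      simp only [Finset.coe_compl, Finset.coe_insert, Set.mem_compl_iff, Set.mem_insert_iff,
        Finset.mem_coe, SimpleGraph.mem_neighborFinset, not_or]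
      exact ⟨h1, fun h => h2 (linked_of_adj hP h)⟩
    refine (Set.ncard_le_ncard hsub (Set.toFinite _)).trans ?_
    rw [Set.ncard_coe_finset, Finset.card_compl, Finset.card_insert_of_notMem (by simp),
      SimpleGraph.card_neighborFinset_eq_degree]
    have := D.underlying.minDegree_le_degree y
    omega
  -- With `m = n - 1 - δ` this is exactly `4 * n + 2 ≤ 5 * δ`.
  have hn : 5 * (Fintype.card V - 1 - D.underlying.minDegree) + 7 ≤ Nat.card V := by
    rw [Nat.card_eq_fintype_card]; omega
  obtain ⟨q, hq, hq2⟩ := exists_isTracing_numCycles_le_two D.tgt P hm hn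
  have hsurj : Function.Surjective D.tgt := surjective_of_linked (by omega) hm
  obtain ⟨a, -⟩ := hsurj (Classical.arbitrary V)
  have hrange : Set.range (Function.periodicOrbit P) = (𝒞 : Set (Cycle A)) := by
    ext C
    constructor
    · rintro ⟨b, rfl⟩
      obtain ⟨C, ⟨hC, hb⟩, -⟩ := h𝒞.2 b
      rw [hPC C hC b hb]
      exact hC
    · intro hC
      obtain ⟨b, hb⟩ : ∃ b, b ∈ C := by
        have h1 := (h𝒞.1 C hC).1
        clear hC
        induction C using Cycle.induction_on with
        | nil => exact absurd rfl h1
        | cons b l _ => exact ⟨b, by simp⟩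
      exact ⟨b, hPC C hC b hb⟩
  have hPcard : P.numCycles = 𝒞.card := by
    rw [← ncard_range_periodicOrbit, hrange, Set.ncard_coe_finset]
  have hqpos : 0 < q.numCycles := by
    have : Nonempty (Quotient (SameCycle.setoid q)) := ⟨⟦a⟧⟩
    exact Nat.card_pos
  have hfaces := ncard_faces_embeddingOfPerms hP hq
  have heven := (embeddingOfPerms P q hP hq).even_faces hsurj
  refine ⟨embeddingOfPerms P q hP hq, isDirected_embeddingOfPerms hP hq, ?_, ?_, ?_, ?_⟩
  · rw [profaceWalks_embeddingOfPerms, hrange]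
  · rintro ⟨k, hk⟩
    obtain ⟨l, hl⟩ := heven
    rw [ncard_antifaces_embeddingOfPerms]
    omega
  · rintro ⟨k, hk⟩
    obtain ⟨l, hl⟩ := heven
    rw [ncard_antifaces_embeddingOfPerms]
    omega
  · intro Ψ hΨ hΨC
    have h1 := Ψ.card_lt_ncard_faces hΨ h𝒞 a hΨC
    -- The constructed embedding has at most two faces more than there are circuits, `Ψ` has at
    -- least one more, and the parities agree.
    have h2 : (embeddingOfPerms P q hP hq).faces.ncard ≤ Ψ.faces.ncard := by
      obtain ⟨k, hk⟩ := heven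
      obtain ⟨l, hl⟩ := Ψ.even_faces hsurj
      omega
    have h3 : ((embeddingOfPerms P q hP hq).faces.ncard : ℚ) ≤ Ψ.faces.ncard := by
      exact_mod_cast h2
    rw [OrientedEmbedding.genus, OrientedEmbedding.genus]
    linarith
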